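/- Setting. Let $\mathrm{Var}$ be a set of quantum variables (countably infinite in the typical case; no cardinality assumption is needed), each of type Boolean, with $\mathcal H_q=\ell^2(\{0,1\})$, or integer, with $\mathcal H_q=\ell^2(\mathbb Z)$. Let $\mathcal H_{\rm all}$ be the Hilbert space with orthonormal basis a nonempty set $\mathcal B$ of product vectors $\bigotimes_q|\sigma_q\rangle$ of computational basis vectors, where $\mathcal B$ is closed under changing finitely many of the $\sigma_q$ (for example all such product vectors, or those with all but finitely many $\sigma_q$ equal to $0$). All operators are bounded. An operator $A$ on the space $\mathcal H_{\bar q}$ of a register $\bar q$ (a finite sequence of distinct variables) is identified with its cylinder extension $A\otimes I$ to $\mathcal H_{\rm all}$; in particular $|v\rangle_q\langle w|$ denotes an operator on $\mathcal H_{\rm all}$. $\sqsubseteq$ is the Löwner order, a partial density operator is a positive trace-class operator $\rho$ with $\mathrm{tr}(\rho)\le 1$, and a quantum predicate is an operator $P$ on $\mathcal H_{\rm all}$ with $0\sqsubseteq P\sqsubseteq I$. Infinite sums of operators converge in the strong operator topology. Programs are generated by $$S::=\mathbf{skip}\mid q:=0\mid \bar q:=U\bar q\mid S_1;S_2\mid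 \mathbf{measure}\ M[\bar q]:\bar S\mid \mathbf{while}\ M[\bar q]=1\ \mathbf{do}\ S,$$ where $U^\dagger U=I$ on $\mathcal H_{\bar q}$, where $M=\{M_m\}$ in the measurement statement is a family of operators on $\mathcal H_{\bar q}$ (indexed by an arbitrary set of outcomes) with $\sum_m M_m^\dagger M_m=I$ and $\bar S=\{S_m\}$ has one program for each outcome, and where $M=\{M_0,M_1\}$ with $M_0^\dagger M_0+M_1^\dagger M_1=I$ in the loop. Configurations are pairs $\langle S,\rho\rangle$, where $S$ is a program or the empty program $E$, with the transitions (and the convention $E;S_2=S_2$) - $\langle\mathbf{skip},\rho\rangle\to\langle E,\rho\rangle$; - $\langle q:=0,\rho\rangle\to\langle E,\sum_v|0\rangle_q\langle v|\rho|v\rangle_q\langle 0|\rangle$, where $v$ ranges over the computational basis labels of $\mathcal H_q$; - $\langle\bar q:=U\bar q,\rho\rangle\to\langle E,U\rho U^\dagger\rangle$; - $\langle S_1;S_2,\rho\rangle\to\langle S_1';S_2,\rho'\rangle$ whenever $\langle S_1,\rho\rangle\to\langle S_1',\rho'\rangle$; - $\langle\mathbf{measure}\ M[\bar q]:\bar S,\rho\rangle\to\langle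 S_m,M_m\rho M_m^\dagger\rangle$ for each outcome $m$; - $\langle\mathbf{while}\ M[\bar q]=1\ \mathbf{do}\ S,\rho\rangle\to\langle E,M_0\rho M_0^\dagger\rangle$ and $\langle\mathbf{while}\ M[\bar q]=1\ \mathbf{do}\ S,\rho\rangle\to\langle S;\mathbf{while}\ M[\bar q]=1\ \mathbf{do}\ S,M_1\rho M_1^\dagger\rangle$. The semantic function is $[\![S]\!](\rho)=\sum\rho'$, the sum over all finite transition sequences from $\langle S,\rho\rangle$ to a configuration $\langle E,\rho'\rangle$ (a multiset sum: different measurement outcomes count as different transitions). For quantum predicates $P,Q$, $\models_{\rm tot}\{Q\}S\{P\}$ means $\mathrm{tr}(Q\rho)\le\mathrm{tr}(P[\![S]\!](\rho))$ for all partial density operators $\rho$ on $\mathcal H_{\rm all}$. The weakest precondition $wp.S.P$ is the quantum predicate with $\models_{\rm tot}\{wp.S.P\}S\{P\}$ such that $Q\sqsubseteq wp.S.P$ for every quantum predicate $Q$ with $\models_{\rm tot}\{Q\}S\{P\}$. Proposition. For every program $S$ and every quantum predicate $P$, the weakest precondition $wp.S.P$ exists and is unique. Moreover, for every quantum predicate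 $P$: 1. (a) $wp.\mathbf{skip}.P=P$. (b) If $q$ is Boolean, then $wp.(q:=0).P=|0\rangle_q\langle0|P|0\rangle_q\langle0|+|1\rangle_q\langle0|P|0\rangle_q\langle1|$; if $q$ is integer, then $wp.(q:=0).P=\sum_{n\in\mathbb Z}|n\rangle_q\langle0|P|0\rangle_q\langle n|$. (c) $wp.(\bar q:=U\bar q).P=U^\dagger PU$. (d) $wp.(S_1;S_2).P=wp.S_1.(wp.S_2.P)$. (e) $wp.(\mathbf{measure}\ M[\bar q]:\bar S).P=\sum_m M_m^\dagger(wp.S_m.P)M_m$. (f) $wp.(\mathbf{while}\ M[\bar q]=1\ \mathbf{do}\ S).P=\bigvee_{n\ge0}P_n$, the supremum in the Löwner order of the increasing sequence of quantum predicates $P_0=0$, $P_{n+1}=M_0^\dagger PM_0+M_1^\dagger(wp.S.P_n)M_1$. 2. For every program $S$ and every partial density operator $\rho$ on $\mathcal H_{\rm all}$, the sum that defines $[\![S]\!](\rho)$ converges to a partial density operator, the diagonals of $(wp.S.P)\rho$ and $P[\![S]\!](\rho)$ are summable in every orthonormal basis, and $$\mathrm{tr}((wp.S.P)\rho)=\mathrm{tr}(P[\![S]\!](\rho)).$$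 -/

import Mathlib

open scoped InnerProduct

namespace QProg

noncomputable section

/-! ### Operators on the Hilbert spaces `ℓ²(X)` -/

/-- The Hilbert space `ℓ²(X)` with computational basis indexed by `X`. -/
abbrev Ell2 (X : Type) : Type := lp (fun _ : X => ℂ) 2

/-- Bounded operators on `ℓ²(X)`. -/
abbrev Op (X : Type) : Type := Ell2 X →L[ℂ] Ell2 X

open Classical in
/-- The computational basis vector `|x⟩`. -/
def ket {X : Type} (x : X) : Ell2 X := lp.single 2 x (1 : ℂ)

/-- The operator `|x⟩⟨y|`. -/
def ketBra {X : Type} (x y : X) : Op X := InnerProductSpace.rankOne ℂ (ket x) (ket y)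

/-- `A` is the sum of the family `f` of bounded operators, in the strong operator topology:
for each vector `ψ`, the family `f i ψ` is (unconditionally) summable with sum `A ψ`. -/
def HasOpSum {X : Type} {ι : Type*} (f : ι → Op X) (A : Op X) : Prop :=
  ∀ ψ : Ell2 X, HasSum (fun i => f i ψ) (A ψ)

open Classical in
/-- The sum of a family of bounded operators (`0` if the family has no sum). -/
def opSum {X : Type} {ι : Type*} (f : ι → Op X) : Op X :=
  if h : ∃ A, HasOpSum f A then h.choose else 0

/-- `A` is a trace operator: its diagonal is summable in every orthonormal basis. -/
def IsTraceOp {X : Type} (A : Op X) : Prop :=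
  ∀ (ι : Type) (b : HilbertBasis ι ℂ (Ell2 X)), Summable fun i => inner ℂ (b i) (A (b i))

/-- The trace (of a trace operator), evaluated in the computational basis. -/
def tr {X : Type} (A : Op X) : ℂ := ∑' x : X, inner ℂ (ket x) (A (ket x))

/-- Partial density operators: positive operators with trace at most one.
The order on operators is Mathlib's Löwner order. -/
def IsPartialDensity {X : Type} (ρ : Op X) : Prop :=
  0 ≤ ρ ∧ IsTraceOp ρ ∧ (tr ρ).re ≤ 1

/-- Quantum predicates: operators `P` with `0 ⊑ P ⊑ I`. -/
def IsPredicate {X : Type} (P : Op X) : Prop := 0 ≤ P ∧ P ≤ 1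

/-! ### Quantum variables, registers and the global state space -/

/-- The two basic types. -/
inductive Ty : Type
  | boolean
  | integer

/-- The labels of the computational basis of the state space of a type: `{0, 1}` (as `Bool`)
for Boolean and `ℤ` for integer. -/
def Ty.Val : Ty → Type
  | .boolean => Bool
  | .integer => ℤ

/-- The label `0`. -/
def Ty.zero : (t : Ty) → t.Val
  | .boolean => false
  | .integer => (0 : ℤ)

/-- The label `1`. -/
def Ty.one : (t : Ty) → t.Val
  | .boolean => true
  | .integer => (1 : ℤ)

/-- The label set of the computational basis of the tensor product of the state spaces of all
quantum variables. A label `σ` stands for the product vector `⨂_q |σ q⟩`. It may be any nonempty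
set of labels that is closed under changing the values of finitely many variables. Hence the set
of all labels is allowed (`GlobalBasis.all`), as well as the set, countable if there are countably
many variables, of all labels with finitely many nonzero values (`GlobalBasis.finSupp`). -/
structure GlobalBasis {Var : Type} (ty : Var → Ty) where
  carrier : Set (∀ q, (ty q).Val)
  nonempty : carrier.Nonempty
  finite_change : ∀ σ ∈ carrier, ∀ τ : ∀ q, (ty q).Val, {q | τ q ≠ σ q}.Finite → τ ∈ carrier

variable {Var : Type} {ty : Var → Ty}

/-- All tensor products of computational basis vectors. -/
def GlobalBasis.all (ty : Var → Ty) : GlobalBasis ty where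
  carrier := Set.univ
  nonempty := ⟨fun q => (ty q).zero, trivial⟩
  finite_change _ _ _ _ := trivial

/-- All tensor products of computational basis vectors, all but finitely many of them `|0⟩`. -/
def GlobalBasis.finSupp (ty : Var → Ty) : GlobalBasis ty where
  carrier := {σ | {q | σ q ≠ (ty q).zero}.Finite}
  nonempty := ⟨fun q => (ty q).zero, by simp⟩
  finite_change σ hσ τ hτ := by
    refine (Set.Finite.union hσ hτ).subset fun q hq => ?_
    by_cases h : τ q = σ q
    · left
      simpa [h] using hq
    · right
      exact h

/-- Labels of the global computational basis. -/
abbrev GlobalBasis.Label (B : GlobalBasis ty) : Type := B.carrier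

/-- Bounded operators on the space of all quantum variables, `H_all = ℓ²(B.Label)`. -/
abbrev GOp (B : GlobalBasis ty) : Type := Op B.Label

/-- Labels of the computational basis of the state space of a register, a finite sequence
`qs` of distinct variables. -/
abbrev RegLabel (ty : Var → Ty) {n : ℕ} (qs : Fin n ↪ Var) : Type := ∀ i, (ty (qs i)).Val

/-- Bounded operators on the state space of the register `qs`. -/
abbrev RegOp (ty : Var → Ty) {n : ℕ} (qs : Fin n ↪ Var) : Type := Op (RegLabel ty qs)

/-- The register that consists of the single variable `q`. -/
def single (q : Var) : Fin 1 ↪ Var := ⟨fun _ => q, fun _ _ _ => Subsingleton.elim _ _⟩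

/-- The basis label of the register `single q` with value `v`. -/
def singleLabel (q : Var) (v : (ty q).Val) : RegLabel ty (single q) := fun _ => v

/-! ### Cylinder extensions -/

section Cylinder

variable (B : GlobalBasis ty) {n : ℕ} (qs : Fin n ↪ Var)

/-- The values of the variables of a register in a global label. -/
def restrict (σ : B.Label) : RegLabel ty qs := fun i => σ.1 (qs i)

open Classical in
/-- `patchFun qs σ s` is `σ` with the values of the variables of the register replaced by `s`. -/
def patchFun (σ : ∀ q, (ty q).Val) (s : RegLabel ty qs) : ∀ q, (ty q).Val := fun q =>
  if h : ∃ i, qs i = q then h.choose_spec ▸ s h.choose else σ q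

theorem patchFun_apply (σ : ∀ q, (ty q).Val) (s : RegLabel ty qs) (i : Fin n) :
    patchFun qs σ s (qs i) = s i := by
  have h : ∃ j, qs j = qs i := ⟨i, rfl⟩
  have key : ∀ (j : Fin n) (hj : qs j = qs i), (hj ▸ s j : (ty (qs i)).Val) = s i := by
    intro j hj
    obtain rfl := qs.injective hj
    rfl
  rw [patchFun, dif_pos h]
  exact key _ h.choose_spec

theorem patchFun_of_notMem (σ : ∀ q, (ty q).Val) (s : RegLabel ty qs) {q : Var}
    (h : ¬ ∃ i, qs i = q) : patchFun qs σ s q = σ q := by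
  rw [patchFun, dif_neg h]

/-- `patch B qs σ s` is the global label `σ` with the values of the variables of the register
replaced by `s`. -/
def patch (σ : B.Label) (s : RegLabel ty qs) : B.Label :=
  ⟨patchFun qs σ.1 s, B.finite_change σ.1 σ.2 _ <| by
    refine (Set.finite_range qs).subset fun q hq => ?_
    by_contra h
    exact hq (patchFun_of_notMem qs σ.1 s h)⟩

theorem restrict_patch (σ : B.Label) (s : RegLabel ty qs) :
    restrict B qs (patch B qs σ s) = s :=
  funext fun i => patchFun_apply qs σ.1 s i

theorem patch_patch (σ : B.Label) (s t : RegLabel ty qs) :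
    patch B qs (patch B qs σ s) t = patch B qs σ t := by
  apply Subtype.ext
  funext q
  by_cases h : ∃ i, qs i = q
  · obtain ⟨i, rfl⟩ := h
    simp only [patch, patchFun_apply]
  · simp only [patch, patchFun_of_notMem qs _ _ h]

theorem patch_restrict (σ : B.Label) : patch B qs σ (restrict B qs σ) = σ := by
  apply Subtype.ext
  funext q
  by_cases h : ∃ i, qs i = q
  · obtain ⟨i, rfl⟩ := h
    simp only [patch, patchFun_apply, restrict]
  · simp only [patch, patchFun_of_notMem qs _ _ h]

theorem patch_injective (σ : B.Label) : Function.Injective (patch B qs σ) := fun s t h => by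
  rw [← restrict_patch B qs σ s, h, restrict_patch]

theorem memℓp_two_iff {X : Type} {f : X → ℂ} :
    Memℓp f 2 ↔ Summable fun x => ‖f x‖ ^ 2 := by
  rw [memℓp_gen_iff (by norm_num)]
  simp

theorem hasSum_norm_sq {X : Type} (ψ : Ell2 X) : HasSum (fun x => ‖ψ x‖ ^ 2) (‖ψ‖ ^ 2) := by
  simpa using lp.hasSum_norm (p := 2) (by norm_num) ψ

/-- The vector `∑_s ψ(σ[qs := s]) |s⟩` of the state space of the register. -/
def slice (σ : B.Label) (ψ : Ell2 B.Label) : Ell2 (RegLabel ty qs) :=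
  ⟨fun s => ψ (patch B qs σ s), memℓp_two_iff.2
    ((hasSum_norm_sq ψ).summable.comp_injective (patch_injective B qs σ))⟩

theorem slice_patch (σ : B.Label) (s : RegLabel ty qs) (ψ : Ell2 B.Label) :
    slice B qs (patch B qs σ s) ψ = slice B qs σ ψ := by
  apply lp.ext
  funext t
  exact congrArg (ψ : B.Label → ℂ) (patch_patch B qs σ s t)

/-- Global labels whose register part is zero; they stand for the labels of the remaining
variables. -/
abbrev EnvLabel : Type := {σ : B.Label // restrict B qs σ = fun _ => Ty.zero _}

/-- Splitting a global label into the part outside the register and the part inside. -/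
def splitEquiv : B.Label ≃ EnvLabel B qs × RegLabel ty qs where
  toFun σ := (⟨patch B qs σ fun _ => Ty.zero _, restrict_patch B qs _ _⟩, restrict B qs σ)
  invFun p := patch B qs p.1.1 p.2
  left_inv σ := by simp only [patch_patch, patch_restrict]
  right_inv p := by
    obtain ⟨⟨e, he⟩, s⟩ := p
    refine Prod.ext (Subtype.ext ?_) (restrict_patch B qs _ _)
    simp only [patch_patch]
    rw [← he, patch_restrict]

theorem hasSum_slice (ψ : Ell2 B.Label) :
    HasSum (fun e : EnvLabel B qs => ‖slice B qs e.1 ψ‖ ^ 2) (‖ψ‖ ^ 2) := by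
  have h := (splitEquiv B qs).symm.hasSum_iff.2 (hasSum_norm_sq ψ)
  exact h.prod_fiberwise fun e => hasSum_norm_sq (slice B qs e.1 ψ)

theorem hasSum_cyl (A : RegOp ty qs) (ψ : Ell2 B.Label) :
    ∃ a ≤ ‖A‖ ^ 2 * ‖ψ‖ ^ 2,
      HasSum (fun σ : B.Label => ‖A (slice B qs σ ψ) (restrict B qs σ)‖ ^ 2) a := by
  have hle : ∀ e : EnvLabel B qs,
      ‖A (slice B qs e.1 ψ)‖ ^ 2 ≤ ‖A‖ ^ 2 * ‖slice B qs e.1 ψ‖ ^ 2 := fun e => by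
    rw [← mul_pow]
    exact pow_le_pow_left₀ (norm_nonneg _) (A.le_opNorm _) 2
  have hψ := (hasSum_slice B qs ψ).mul_left (‖A‖ ^ 2)
  have hs : Summable fun e : EnvLabel B qs => ‖A (slice B qs e.1 ψ)‖ ^ 2 :=
    Summable.of_nonneg_of_le (fun _ => by positivity) hle hψ.summable
  refine ⟨_, hasSum_le hle hs.hasSum hψ, ?_⟩
  have hfib : ∀ e : EnvLabel B qs,
      HasSum (fun s => ‖A (slice B qs e.1 ψ) s‖ ^ 2) (‖A (slice B qs e.1 ψ)‖ ^ 2) :=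
    fun e => hasSum_norm_sq _
  have hp : Summable fun p : EnvLabel B qs × RegLabel ty qs =>
      ‖A (slice B qs p.1.1 ψ) p.2‖ ^ 2 := by
    refine (summable_prod_of_nonneg fun _ => by positivity).2
      ⟨fun e => (hfib e).summable, ?_⟩
    simpa only [(hfib _).tsum_eq] using hs
  have htot := hp.hasSum
  rw [← htot.prod_fiberwise hfib |>.tsum_eq] at htot
  have := (splitEquiv B qs).hasSum_iff.2 htot
  refine this.congr_fun ?_
  intro σ
  simp only [Function.comp, splitEquiv, Equiv.coe_fn_mk, slice_patch]

/-- The value at `ψ` of the cylinder extension of `A`. -/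
def cylVec (A : RegOp ty qs) (ψ : Ell2 B.Label) : Ell2 B.Label :=
  ⟨fun σ => A (slice B qs σ ψ) (restrict B qs σ), by
    obtain ⟨a, -, h⟩ := hasSum_cyl B qs A ψ
    exact memℓp_two_iff.2 h.summable⟩

theorem norm_cylVec_le (A : RegOp ty qs) (ψ : Ell2 B.Label) :
    ‖cylVec B qs A ψ‖ ≤ ‖A‖ * ‖ψ‖ := by
  obtain ⟨a, ha, h⟩ := hasSum_cyl B qs A ψ
  have h2 : ‖cylVec B qs A ψ‖ ^ 2 = a := (hasSum_norm_sq (cylVec B qs A ψ)).unique h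
  refine (sq_le_sq₀ (norm_nonneg _) (by positivity)).1 ?_
  rw [mul_pow, h2]
  exact ha

theorem cylVec_add (A : RegOp ty qs) (ψ φ : Ell2 B.Label) :
    cylVec B qs A (ψ + φ) = cylVec B qs A ψ + cylVec B qs A φ := by
  apply lp.ext
  funext σ
  have h : slice B qs σ (ψ + φ) = slice B qs σ ψ + slice B qs σ φ := rfl
  change A (slice B qs σ (ψ + φ)) (restrict B qs σ) =
    A (slice B qs σ ψ) (restrict B qs σ) + A (slice B qs σ φ) (restrict B qs σ)
  rw [h, map_add]
  rfl

theorem cylVec_smul (A : RegOp ty qs) (c : ℂ) (ψ : Ell2 B.Label) :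
    cylVec B qs A (c • ψ) = c • cylVec B qs A ψ := by
  apply lp.ext
  funext σ
  have h : slice B qs σ (c • ψ) = c • slice B qs σ ψ := rfl
  change A (slice B qs σ (c • ψ)) (restrict B qs σ) =
    c • A (slice B qs σ ψ) (restrict B qs σ)
  rw [h, map_smul]
  rfl

/-- The cylinder extension `A ⊗ I` to the space of all variables of an operator `A` on the state
space of a register: `A` acts on the register part of a vector, for each fixed value of the other
variables. -/
def cyl (A : RegOp ty qs) : GOp B :=
  LinearMap.mkContinuous
    { toFun := cylVec B qs A
      map_add' := cylVec_add B qs A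
      map_smul' := cylVec_smul B qs A }
    ‖A‖ (norm_cylVec_le B qs A)

theorem cyl_apply (A : RegOp ty qs) (ψ : Ell2 B.Label) (σ : B.Label) :
    cyl B qs A ψ σ = A (slice B qs σ ψ) (restrict B qs σ) := rfl

end Cylinder

/-- The operator `|v⟩_q⟨w|` on the space of all variables. -/
def ketBraAt (B : GlobalBasis ty) (q : Var) (v w : (ty q).Val) : GOp B :=
  cyl B (single q) (ketBra (singleLabel q v) (singleLabel q w))

/-! ### Quantum while-programs -/

/-- Quantum programs; `init q` is `q := 0`, and `loop qs M₀ M₁ hM S` is the statement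
`while M[qs] = 1 do S`. The outcomes of a measurement form an arbitrary set `ι`. -/
inductive Prog (ty : Var → Ty) : Type 1
  | skip : Prog ty
  | init (q : Var) : Prog ty
  | unitary {n : ℕ} (qs : Fin n ↪ Var) (U : RegOp ty qs) (hU : U† * U = 1) : Prog ty
  | seq (S₁ S₂ : Prog ty) : Prog ty
  | measure {n : ℕ} (qs : Fin n ↪ Var) {ι : Type} (M : ι → RegOp ty qs)
      (hM : HasOpSum (fun m => (M m)† * M m) 1) (S : ι → Prog ty) : Prog ty
  | loop {n : ℕ} (qs : Fin n ↪ Var) (M₀ M₁ : RegOp ty qs)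
      (hM : M₀† * M₀ + M₁† * M₁ = 1) (S : Prog ty) : Prog ty

/-- The transition rules. `Step B C ρ C' ρ'` is the type of the derivations of
`⟨C, ρ⟩ → ⟨C', ρ'⟩`, where the program part `none` is the empty program `E`. It is a type and not
a proposition, so that transitions for different outcomes of a measurement count as different
even if they lead to the same configuration. -/
inductive Step (B : GlobalBasis ty) :
    Option (Prog ty) → GOp B → Option (Prog ty) → GOp B → Type 1
  | skip (ρ : GOp B) : Step B (some .skip) ρ none ρ
  | init (q : Var) (ρ : GOp B) :
      Step B (some (.init q)) ρ none
        (opSum fun v : (ty q).Val => ketBraAt B q (ty q).zero v * ρ * ketBraAt B q v (ty q).zero)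
  | unitary {n : ℕ} (qs : Fin n ↪ Var) (U : RegOp ty qs) (hU : U† * U = 1) (ρ : GOp B) :
      Step B (some (.unitary qs U hU)) ρ none (cyl B qs U * ρ * (cyl B qs U)†)
  | seq {S₁ S₁' : Prog ty} (S₂ : Prog ty) {ρ ρ' : GOp B} :
      Step B (some S₁) ρ (some S₁') ρ' → Step B (some (.seq S₁ S₂)) ρ (some (.seq S₁' S₂)) ρ'
  | seqE {S₁ : Prog ty} (S₂ : Prog ty) {ρ ρ' : GOp B} :
      Step B (some S₁) ρ none ρ' → Step B (some (.seq S₁ S₂)) ρ (some S₂) ρ'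
  | measure {n : ℕ} (qs : Fin n ↪ Var) {ι : Type} (M : ι → RegOp ty qs)
      (hM : HasOpSum (fun m => (M m)† * M m) 1) (S : ι → Prog ty) (ρ : GOp B) (m : ι) :
      Step B (some (.measure qs M hM S)) ρ (some (S m)) (cyl B qs (M m) * ρ * (cyl B qs (M m))†)
  | loop₀ {n : ℕ} (qs : Fin n ↪ Var) (M₀ M₁ : RegOp ty qs)
      (hM : M₀† * M₀ + M₁† * M₁ = 1) (S : Prog ty) (ρ : GOp B) :
      Step B (some (.loop qs M₀ M₁ hM S)) ρ none (cyl B qs M₀ * ρ * (cyl B qs M₀)†)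
  | loop₁ {n : ℕ} (qs : Fin n ↪ Var) (M₀ M₁ : RegOp ty qs)
      (hM : M₀† * M₀ + M₁† * M₁ = 1) (S : Prog ty) (ρ : GOp B) :
      Step B (some (.loop qs M₀ M₁ hM S)) ρ (some (.seq S (.loop qs M₀ M₁ hM S)))
        (cyl B qs M₁ * ρ * (cyl B qs M₁)†)

/-- Terminating computations: finite sequences of transitions from `⟨C, ρ⟩` to `⟨E, ρ'⟩`. -/
inductive Run (B : GlobalBasis ty) : Option (Prog ty) → GOp B → GOp B → Type 1
  | done (ρ : GOp B) : Run B none ρ ρ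
  | step {S : Prog ty} {C' : Option (Prog ty)} {ρ ρ' ρ'' : GOp B} :
      Step B (some S) ρ C' ρ' → Run B C' ρ' ρ'' → Run B (some S) ρ ρ''

/-- The terminating computations of `S` that start in `ρ`, with their final states. -/
abbrev Computation (B : GlobalBasis ty) (S : Prog ty) (ρ : GOp B) : Type 1 :=
  Σ ρ' : GOp B, Run B (some S) ρ ρ'

/-- The semantic function `⟦S⟧`: the sum of the final states of all terminating computations. -/
def sem (B : GlobalBasis ty) (S : Prog ty) (ρ : GOp B) : GOp B :=
  opSum fun c : Computation B S ρ => c.1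

/-! ### Total correctness and weakest preconditions -/

/-- Total correctness of `{P} S {Q}`. -/
def TotallyCorrect (B : GlobalBasis ty) (P : GOp B) (S : Prog ty) (Q : GOp B) : Prop :=
  ∀ ρ : GOp B, IsPartialDensity ρ → (tr (P * ρ)).re ≤ (tr (Q * sem B S ρ)).re

/-- `W` is a weakest precondition of `S` with respect to `P`. -/
def IsWP (B : GlobalBasis ty) (S : Prog ty) (P W : GOp B) : Prop :=
  IsPredicate W ∧ TotallyCorrect B W S P ∧
    ∀ Q : GOp B, IsPredicate Q → TotallyCorrect B Q S P → Q ≤ W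

open Classical in
/-- The weakest precondition `wp.S.P` (`0` if there is none). -/
def wp (B : GlobalBasis ty) (S : Prog ty) (P : GOp B) : GOp B :=
  if h : ∃ W, IsWP B S P W then h.choose else 0

/-- The approximations of the weakest precondition of a loop:
`P₀ = 0` and `Pₙ₊₁ = M₀† P M₀ + M₁† (wp.S.Pₙ) M₁`. -/
def loopSeq (B : GlobalBasis ty) {n : ℕ} (qs : Fin n ↪ Var) (M₀ M₁ : RegOp ty qs)
    (S : Prog ty) (P : GOp B) : ℕ → GOp B
  | 0 => 0
  | k + 1 => (cyl B qs M₀)† * P * cyl B qs M₀ +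
      (cyl B qs M₁)† * wp B S (loopSeq B qs M₀ M₁ S P k) * cyl B qs M₁

end

end QProg

open scoped InnerProduct
open QProg

namespace QProg

open scoped ENNReal ComplexOrder

/-! ### Positive operators -/

section Positive

variable {X : Type}

/-! The proof is the duality between transforming states and transforming predicates. For positive
operators, `pairing A B` is `tr (√A B √A)` with values in `ℝ≥0∞`, so that sums of any size may be
rearranged without convergence proofs. It is symmetric (`pairing_comm`), additive over strong
operator sums in either argument, and moves a Kraus operator from one side to the other
(`pairing_conj`).

For a postcondition `P`, let `runTotal` add up `pairing P` over the final states of all terminating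
computations from `ρ`. By induction on the program this total equals `pairing W ρ` for a predicate
`W` (`exists_isDual`), and the steps of the induction are exactly the recursion equations to be
proved for `wp`. In the loop case the approximants `P_k` are squeezed between the totals over
computations of bounded length and the full total (`exists_isDual_loop`).

Everything follows from this dual `W`. With `P = 1` it bounds the total trace of the final states by
`tr ρ`, so the sum defining the semantics converges (`IsDual.hasOpSum_sem`). Hence `Q` is a correct
precondition for `P` iff `pairing Q ρ ≤ pairing W ρ` for every `ρ`; testing rank-one states turns
this into `Q ≤ W` (`le_of_pairing_le`), so `W` is the weakest precondition. The link between
`pairing` and the complex trace `tr` is `tr_mul_eq`, obtained by polarisation from Hilbert-Schmidt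
norms. -/

theorem exists_root {H : Type*} [NormedAddCommGroup H] [InnerProductSpace ℂ H]
    [CompleteSpace H] {A : H →L[ℂ] H} (hA : 0 ≤ A) : ∃ R : H →L[ℂ] H, R† = R ∧ R * R = A := by
  rw [ContinuousLinearMap.nonneg_iff_isPositive] at hA
  obtain ⟨p, hp, -, hpA⟩ := CFC.exists_sqrt_of_isSelfAdjoint_of_quasispectrumRestricts
    hA.isSelfAdjoint hA.spectrumRestricts
  exact ⟨p, hp.star_eq, by rw [← sq]; exact hpA⟩

open Classical in
/-- A self-adjoint square root of a positive operator. -/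
noncomputable def root (A : Op X) : Op X := if hA : 0 ≤ A then (exists_root hA).choose else 0

theorem root_adjoint (A : Op X) : (root A)† = root A := by
  unfold root
  split_ifs with hA
  · exact (exists_root hA).choose_spec.1
  · simp

theorem root_mul_root {A : Op X} (hA : 0 ≤ A) : root A * root A = A := by
  rw [root, dif_pos hA]
  exact (exists_root hA).choose_spec.2

theorem adjoint_mul (A B : Op X) : (A * B)† = B† * A† := ContinuousLinearMap.adjoint_comp A B

theorem inner_nonneg {A : Op X} (hA : 0 ≤ A) (ψ : Ell2 X) : 0 ≤ inner ℂ ψ (A ψ) :=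
  ((ContinuousLinearMap.nonneg_iff_isPositive A).1 hA).inner_nonneg_right ψ

theorem nonneg_of_inner_nonneg {A : Op X} (h : ∀ ψ, 0 ≤ inner ℂ ψ (A ψ)) : 0 ≤ A := by
  rw [ContinuousLinearMap.nonneg_iff_isPositive, ContinuousLinearMap.isPositive_iff_complex]
  intro ψ
  have h1 := h ψ
  rw [Complex.nonneg_iff] at h1
  have hc : inner ℂ (A ψ) ψ = inner ℂ ψ (A ψ) := by
    rw [← inner_conj_symm, Complex.conj_eq_iff_im]
    exact h1.2.symm
  rw [hc]
  exact ⟨Complex.ext rfl h1.2, h1.1⟩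

theorem adjoint_eq_self {A : Op X} (hA : 0 ≤ A) : A† = A :=
  ((ContinuousLinearMap.nonneg_iff_isPositive A).1 hA).isSelfAdjoint.star_eq

theorem conj_nonneg {A : Op X} (hA : 0 ≤ A) (K : Op X) : 0 ≤ K * A * K† :=
  star_right_conjugate_nonneg hA K

theorem conj_nonneg' {A : Op X} (hA : 0 ≤ A) (K : Op X) : 0 ≤ K† * A * K :=
  star_left_conjugate_nonneg hA K

theorem conj_mono' {A A' : Op X} (h : A ≤ A') (K : Op X) : K† * A * K ≤ K† * A' * K :=
  star_left_conjugate_le_conjugate h K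

theorem adjoint_mul_self_nonneg (K : Op X) : 0 ≤ K† * K := star_mul_self_nonneg K

/-- The quadratic form of a positive operator. -/
noncomputable def quad (A : Op X) (ψ : Ell2 X) : ℝ≥0∞ := ENNReal.ofReal (inner ℂ ψ (A ψ)).re

theorem quad_mono {A B : Op X} (h : A ≤ B) (ψ : Ell2 X) : quad A ψ ≤ quad B ψ := by
  refine ENNReal.ofReal_le_ofReal ?_
  have := (Complex.nonneg_iff.1 (inner_nonneg (sub_nonneg.2 h) ψ)).1
  simpa [inner_sub_right] using this

/-- `quad` truncates negative values to `0`; this loses nothing as long as the right-hand side is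
nonnegative. -/
theorem inner_le_of_quad_le {A B : Op X} (hB : 0 ≤ B) {ψ : Ell2 X} (h : quad A ψ ≤ quad B ψ) :
    (inner ℂ ψ (A ψ)).re ≤ (inner ℂ ψ (B ψ)).re :=
  (ENNReal.ofReal_le_ofReal_iff (Complex.nonneg_iff.1 (inner_nonneg hB ψ)).1).1 h

theorem le_of_quad_le {A B : Op X} (hA : 0 ≤ A) (hB : 0 ≤ B) (h : ∀ ψ, quad A ψ ≤ quad B ψ) :
    A ≤ B := by
  rw [← sub_nonneg]
  refine nonneg_of_inner_nonneg fun ψ => ?_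
  have hA' := Complex.nonneg_iff.1 (inner_nonneg hA ψ)
  have hB' := Complex.nonneg_iff.1 (inner_nonneg hB ψ)
  have := inner_le_of_quad_le hB (h ψ)
  rw [Complex.nonneg_iff]
  simp only [sub_apply, inner_sub_right, Complex.sub_re, Complex.sub_im]
  exact ⟨by linarith, by rw [← hA'.2, ← hB'.2, sub_zero]⟩

theorem quad_adjoint_mul_self (K : Op X) (ψ : Ell2 X) : quad (K† * K) ψ = ‖K ψ‖ₑ ^ 2 := by
  have h : inner ℂ ψ ((K† * K) ψ) = ((‖K ψ‖ ^ 2 : ℝ) : ℂ) := by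
    rw [mul_apply_eq_comp, ContinuousLinearMap.adjoint_inner_right,
      inner_self_eq_norm_sq_to_K]
    norm_cast
  rw [quad, h, Complex.ofReal_re, ENNReal.ofReal_pow (norm_nonneg _), ofReal_norm]

theorem quad_eq {A : Op X} (hA : 0 ≤ A) (ψ : Ell2 X) : quad A ψ = ‖root A ψ‖ₑ ^ 2 := by
  rw [← quad_adjoint_mul_self, root_adjoint, root_mul_root hA]

theorem quad_conj (A K : Op X) (ψ : Ell2 X) : quad (K† * A * K) ψ = quad A (K ψ) := by
  simp only [quad, mul_apply_eq_comp, ContinuousLinearMap.adjoint_inner_right]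

theorem HasOpSum.unique {ι : Type*} {f : ι → Op X} {A B : Op X} (hA : HasOpSum f A)
    (hB : HasOpSum f B) : A = B :=
  ContinuousLinearMap.ext fun ψ => (hA ψ).unique (hB ψ)

theorem HasOpSum.opSum_eq {ι : Type*} {f : ι → Op X} {A : Op X} (hA : HasOpSum f A) :
    opSum f = A := by
  have h : ∃ A, HasOpSum f A := ⟨A, hA⟩
  rw [opSum, dif_pos h]
  exact h.choose_spec.unique hA

theorem HasOpSum.hasSum_inner {ι : Type*} {f : ι → Op X} {A : Op X} (hA : HasOpSum f A)
    (φ ψ : Ell2 X) : HasSum (fun i => inner ℂ φ (f i ψ)) (inner ℂ φ (A ψ)) :=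
  (hA ψ).mapL (innerSL ℂ φ)

theorem HasOpSum.nonneg {ι : Type*} {f : ι → Op X} {A : Op X} (hA : HasOpSum f A)
    (hf : ∀ i, 0 ≤ f i) : 0 ≤ A := by
  refine nonneg_of_inner_nonneg fun ψ => ?_
  have h := hA.hasSum_inner ψ ψ
  have hi := fun i => Complex.nonneg_iff.1 (inner_nonneg (hf i) ψ)
  rw [Complex.nonneg_iff]
  refine ⟨(Complex.hasSum_re h).nonneg fun i => (hi i).1, ?_⟩
  have h0 := Complex.hasSum_im h
  simp only [← (hi _).2] at h0
  exact hasSum_zero.unique h0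

theorem HasOpSum.quad_eq_tsum {ι : Type*} {f : ι → Op X} {A : Op X} (hA : HasOpSum f A)
    (hf : ∀ i, 0 ≤ f i) (ψ : Ell2 X) : quad A ψ = ∑' i, quad (f i) ψ := by
  have h := Complex.hasSum_re (hA.hasSum_inner ψ ψ)
  rw [quad, ← h.tsum_eq, ENNReal.ofReal_tsum_of_nonneg
    (fun i => (Complex.nonneg_iff.1 (inner_nonneg (hf i) ψ)).1) h.summable]
  rfl

theorem hasOpSum_add (A B : Op X) : HasOpSum (fun b : Bool => if b then A else B) (A + B) := by
  intro ψ
  have := hasSum_fintype fun b : Bool => (if b then A else B) ψ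
  simpa using this

theorem quad_one (ψ : Ell2 X) : quad 1 ψ = ‖ψ‖ₑ ^ 2 := by
  have h : (1 : Op X)† * 1 = 1 := by
    rw [mul_one]
    exact star_one (Op X)
  rw [← h, quad_adjoint_mul_self]
  rfl

/-- Conjugate `A ≤ 1` by `√A`: then `A² = √A A √A ≤ √A √A = A`. -/
theorem adjoint_mul_self_of_le_one {A : Op X} (h0 : 0 ≤ A) (h1 : A ≤ 1) : A† * A ≤ A := by
  have hR := root_mul_root h0
  have hR' := root_adjoint A
  have h2 := conj_mono' h1 (root A)
  rw [hR', mul_one, hR] at h2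
  calc A† * A = root A * A * root A := by
        rw [adjoint_eq_self h0]
        -- Stated for a variable root `R`, so that `A` can be substituted away; `root A` itself
        -- mentions `A`.
        have h3 : ∀ R : Op X, R * R = A → A * A = R * A * R := by
          rintro R rfl
          simp only [mul_assoc]
        exact h3 _ hR
    _ ≤ A := h2

theorem norm_apply_sq_le {A : Op X} (h0 : 0 ≤ A) (h1 : A ≤ 1) (ψ : Ell2 X) :
    ‖A ψ‖ₑ ^ 2 ≤ quad A ψ := by
  rw [← quad_adjoint_mul_self]
  exact quad_mono (adjoint_mul_self_of_le_one h0 h1) ψ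

theorem quad_finset_sum {ι : Type*} {f : ι → Op X} (hf : ∀ i, 0 ≤ f i) (s : Finset ι)
    (ψ : Ell2 X) : quad (∑ i ∈ s, f i) ψ = ∑ i ∈ s, quad (f i) ψ := by
  simp only [quad, sum_apply, inner_sum, Complex.re_sum]
  exact ENNReal.ofReal_sum_of_nonneg fun i _ => (Complex.nonneg_iff.1 (inner_nonneg (hf i) ψ)).1

/-- A family of positive operators whose finite partial sums are at most `1` is summable in the
strong operator topology. -/
theorem exists_hasOpSum {ι : Type*} {f : ι → Op X} (hf : ∀ i, 0 ≤ f i)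
    (h1 : ∀ s : Finset ι, ∑ i ∈ s, f i ≤ 1) : ∃ A, HasOpSum f A ∧ 0 ≤ A ∧ A ≤ 1 := by
  have hs : ∀ (s : Finset ι) (ψ : Ell2 X),
      ‖∑ i ∈ s, f i ψ‖ₑ ^ 2 ≤ ∑ i ∈ s, quad (f i) ψ := fun s ψ => by
    have := norm_apply_sq_le (Finset.sum_nonneg fun i _ => hf i) (h1 s) ψ
    rwa [quad_finset_sum hf, sum_apply] at this
  have hle : ∀ (s : Finset ι) (ψ : Ell2 X), ∑ i ∈ s, quad (f i) ψ ≤ ‖ψ‖ₑ ^ 2 := fun s ψ => by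
    rw [← quad_finset_sum hf, ← quad_one]
    exact quad_mono (h1 s) ψ
  -- Cauchy criterion: by `hs`, the squared norm of a finite block of the vector series is at most
  -- the same block of the convergent scalar series of quadratic forms, whence the tolerance `ε ^ 2`
  -- below.
  have hsum : ∀ ψ : Ell2 X, Summable fun i => f i ψ := by
    intro ψ
    have hfin : ∑' i, quad (f i) ψ ≠ ∞ := by
      rw [ENNReal.tsum_eq_iSup_sum]
      exact ((iSup_le fun s => hle s ψ).trans_lt (by simp)).ne
    rw [summable_iff_vanishing_norm]
    intro ε hε
    have hreal : Summable fun i => (quad (f i) ψ).toReal := ENNReal.summable_toReal hfin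
    obtain ⟨s, hs'⟩ := summable_iff_vanishing_norm.1 hreal (ε ^ 2) (by positivity)
    refine ⟨s, fun t ht => ?_⟩
    have h2 := hs' t ht
    have hq : ∀ i, quad (f i) ψ ≠ ∞ := ENNReal.ne_top_of_tsum_ne_top hfin
    have h3 := ENNReal.toReal_mono (by simp [hq]) (hs t ψ)
    rw [ENNReal.toReal_sum fun i _ => hq i, ENNReal.toReal_pow, toReal_enorm] at h3
    have h4 := (h3.trans (le_abs_self _)).trans_lt h2
    exact lt_of_pow_lt_pow_left₀ 2 hε.le h4
  have hbound : ∀ ψ : Ell2 X, ‖∑' i, f i ψ‖ ≤ 1 * ‖ψ‖ := by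
    intro ψ
    refine le_of_tendsto (hsum ψ).hasSum.norm (Filter.Eventually.of_forall fun s => ?_)
    have h2 := (hs s ψ).trans (hle s ψ)
    have h3 := ENNReal.toReal_mono (by simp) h2
    rw [ENNReal.toReal_pow, ENNReal.toReal_pow, toReal_enorm, toReal_enorm] at h3
    rw [one_mul]
    exact (sq_le_sq₀ (norm_nonneg _) (norm_nonneg _)).1 h3
  let A : Op X := LinearMap.mkContinuous
    { toFun := fun ψ => ∑' i, f i ψ
      map_add' := fun ψ φ => by
        simp only [map_add]
        exact (hsum ψ).tsum_add (hsum φ)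
      map_smul' := fun c ψ => by
        simp only [map_smul, RingHom.id_apply]
        exact (hsum ψ).tsum_const_smul c } 1 hbound
  have hA : HasOpSum f A := fun ψ => (hsum ψ).hasSum
  refine ⟨A, hA, hA.nonneg hf, le_of_quad_le (hA.nonneg hf) zero_le_one fun ψ => ?_⟩
  rw [hA.quad_eq_tsum hf, ENNReal.tsum_eq_iSup_sum, quad_one]
  exact iSup_le fun s => hle s ψ

end Positive

/-! ### The trace pairing of positive operators -/

section Pairing

variable {X : Type}

/-- The computational basis as a Hilbert basis. -/
noncomputable def ketBasis (X : Type) : HilbertBasis X ℂ (Ell2 X) :=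
  HilbertBasis.ofRepr (LinearIsometryEquiv.refl ℂ (Ell2 X))

theorem ketBasis_apply (x : X) : ketBasis X x = ket x := rfl

theorem tsum_enorm_inner_sq {ι : Type*} (b : HilbertBasis ι ℂ (Ell2 X)) (ψ : Ell2 X) :
    ∑' i, ‖inner ℂ (b i) ψ‖ₑ ^ 2 = ‖ψ‖ₑ ^ 2 := by
  have h := b.hasSum_inner_mul_inner ψ ψ
  have h2 := Complex.hasSum_re h
  have h3 : ∀ i, (inner ℂ ψ (b i) * inner ℂ (b i) ψ).re = ‖inner ℂ (b i) ψ‖ ^ 2 := fun i => by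
    rw [← inner_conj_symm ψ (b i), Complex.conj_mul']
    norm_cast
  have h4 : (inner ℂ ψ ψ).re = ‖ψ‖ ^ 2 := by
    rw [inner_self_eq_norm_sq_to_K]
    norm_cast
  simp only [h3, h4] at h2
  rw [← ofReal_norm, ← ENNReal.ofReal_pow (norm_nonneg _), ← h2.tsum_eq,
    ENNReal.ofReal_tsum_of_nonneg (fun _ => by positivity) h2.summable]
  simp only [ENNReal.ofReal_pow (norm_nonneg _), ofReal_norm]

/-- By Parseval both sides are the double sum of `|⟨c j, A (b i)⟩|²`, taken in the two orders. Since
one side does not involve `b` and the other does not involve `c`, this also gives basis independence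
of the Hilbert-Schmidt norm. -/
theorem tsum_enorm_apply_sq {ι κ : Type*} (b : HilbertBasis ι ℂ (Ell2 X))
    (c : HilbertBasis κ ℂ (Ell2 X)) (A : Op X) :
    ∑' i, ‖A (b i)‖ₑ ^ 2 = ∑' j, ‖(A†) (c j)‖ₑ ^ 2 := by
  simp only [← tsum_enorm_inner_sq c (A _), ← tsum_enorm_inner_sq b ((A†) _)]
  rw [ENNReal.tsum_comm]
  refine tsum_congr fun j => tsum_congr fun i => ?_
  rw [ContinuousLinearMap.adjoint_inner_right, ← inner_conj_symm (A (b i)), RCLike.enorm_conj]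

/-- The square of the Hilbert-Schmidt norm. -/
noncomputable def hs (A : Op X) : ℝ≥0∞ := ∑' x, ‖A (ket x)‖ₑ ^ 2

theorem hs_adjoint (A : Op X) : hs (A†) = hs A :=
  (tsum_enorm_apply_sq (ketBasis X) (ketBasis X) A).symm

theorem tsum_basis_eq_hs {ι : Type*} (b : HilbertBasis ι ℂ (Ell2 X)) (A : Op X) :
    ∑' i, ‖A (b i)‖ₑ ^ 2 = hs A := by
  rw [← hs_adjoint]
  exact tsum_enorm_apply_sq b (ketBasis X) A

/-- The trace pairing `tr (A B)` of positive operators `A` and `B`, as an extended real. -/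
noncomputable def pairing (A B : Op X) : ℝ≥0∞ := ∑' x, quad B (root A (ket x))

theorem pairing_eq_hs (A : Op X) {B : Op X} (hB : 0 ≤ B) :
    pairing A B = hs (root B * root A) := by
  simp only [pairing, quad_eq hB, hs, mul_apply_eq_comp]

/-- `√B √A` and `√A √B` are adjoint to each other and so have the same Hilbert-Schmidt norm.
Additivity and monotonicity of the pairing are visible only in its second argument; symmetry carries
them over to the first. -/
theorem pairing_comm {A B : Op X} (hA : 0 ≤ A) (hB : 0 ≤ B) : pairing A B = pairing B A := by
  rw [pairing_eq_hs A hB, pairing_eq_hs B hA, ← hs_adjoint, adjoint_mul, root_adjoint,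
    root_adjoint]

theorem pairing_mono_right (A : Op X) {B B' : Op X} (h : B ≤ B') :
    pairing A B ≤ pairing A B' := ENNReal.tsum_le_tsum fun _ => quad_mono h _

theorem pairing_mono_left {A A' B : Op X} (hA : 0 ≤ A) (hB : 0 ≤ B) (h : A ≤ A') :
    pairing A B ≤ pairing A' B := by
  rw [pairing_comm hA hB, pairing_comm (hA.trans h) hB]
  exact pairing_mono_right B h

theorem pairing_hasOpSum_right (A : Op X) {ι : Type*} {f : ι → Op X} {B : Op X}
    (hf : ∀ i, 0 ≤ f i) (hB : HasOpSum f B) : pairing A B = ∑' i, pairing A (f i) := by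
  simp only [pairing, hB.quad_eq_tsum hf]
  exact ENNReal.tsum_comm

theorem pairing_hasOpSum_left {ι : Type*} {f : ι → Op X} {A B : Op X} (hB : 0 ≤ B)
    (hf : ∀ i, 0 ≤ f i) (hA : HasOpSum f A) : pairing A B = ∑' i, pairing (f i) B := by
  rw [pairing_comm (hA.nonneg hf) hB, pairing_hasOpSum_right B hf hA]
  exact tsum_congr fun i => pairing_comm hB (hf i)

theorem pairing_add_left {A A' B : Op X} (hA : 0 ≤ A) (hA' : 0 ≤ A') (hB : 0 ≤ B) :
    pairing (A + A') B = pairing A B + pairing A' B := by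
  rw [pairing_hasOpSum_left hB (fun b => by cases b <;> simpa) (hasOpSum_add A A'),
    tsum_fintype]
  simp

theorem pairing_finset_sum_left {ι : Type*} {f : ι → Op X} {B : Op X} (hB : 0 ≤ B)
    (hf : ∀ i, 0 ≤ f i) (s : Finset ι) :
    pairing (∑ i ∈ s, f i) B = ∑ i ∈ s, pairing (f i) B := by
  have h : HasOpSum (fun i : s => f i) (∑ i ∈ s, f i) := fun ψ => by
    rw [sum_apply, ← Finset.sum_coe_sort]
    exact hasSum_fintype _
  rw [pairing_hasOpSum_left hB (f := fun i : s => f i) (fun i => hf i) h, tsum_fintype]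
  exact Finset.sum_coe_sort s fun i => pairing (f i) B

theorem pairing_finset_sum_right (A : Op X) {ι : Type*} {f : ι → Op X}
    (hf : ∀ i, 0 ≤ f i) (s : Finset ι) :
    pairing A (∑ i ∈ s, f i) = ∑ i ∈ s, pairing A (f i) := by
  have h : HasOpSum (fun i : s => f i) (∑ i ∈ s, f i) := fun ψ => by
    rw [sum_apply, ← Finset.sum_coe_sort]
    exact hasSum_fintype _
  rw [pairing_hasOpSum_right A (f := fun i : s => f i) (fun i => hf i) h, tsum_fintype]
  exact Finset.sum_coe_sort s fun i => pairing A (f i)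

/-- Both sides are the squared Hilbert-Schmidt norm of `√A K √B` or of its adjoint. This is the step
that trades a state transformation for a predicate transformation. -/
theorem pairing_conj {A B : Op X} (hA : 0 ≤ A) (hB : 0 ≤ B) (K : Op X) :
    pairing (K† * A * K) B = pairing A (K * B * K†) := by
  have h1 : pairing B (K† * A * K) = hs (root A * K * root B) := by
    simp only [pairing, quad_conj, quad_eq hA, hs, mul_apply_eq_comp]
  have h2 : pairing A (K * B * K†) = hs (root B * K† * root A) := by
    have h3 : K * B * K† = K†† * B * K† := by rw [ContinuousLinearMap.adjoint_adjoint]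
    rw [h3]
    simp only [pairing, quad_conj, quad_eq hB, hs, mul_apply_eq_comp]
  rw [pairing_comm (conj_nonneg' hA K) hB, h1, h2, ← hs_adjoint]
  simp only [adjoint_mul, root_adjoint, mul_assoc]

/-- The operator `|ψ⟩⟨ψ|`. -/
noncomputable def proj (ψ : Ell2 X) : Op X := InnerProductSpace.rankOne ℂ ψ ψ

theorem inner_proj (ψ φ : Ell2 X) :
    inner ℂ φ (proj ψ φ) = ((‖inner ℂ ψ φ‖ ^ 2 : ℝ) : ℂ) := by
  rw [proj, InnerProductSpace.rankOne_apply, inner_smul_right, ← inner_conj_symm φ ψ,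
    Complex.mul_conj']
  norm_cast

theorem proj_nonneg (ψ : Ell2 X) : 0 ≤ proj ψ := by
  refine nonneg_of_inner_nonneg fun φ => ?_
  rw [inner_proj]
  exact Complex.zero_le_real.2 (by positivity)

theorem quad_proj (ψ φ : Ell2 X) : quad (proj ψ) φ = ‖inner ℂ φ ψ‖ₑ ^ 2 := by
  rw [quad, inner_proj, Complex.ofReal_re, ENNReal.ofReal_pow (norm_nonneg _), ofReal_norm,
    ← inner_conj_symm, RCLike.enorm_conj]

/-- Parseval for the vector `√A ψ`. Rank-one states thus recover the quadratic form of `A`. -/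
theorem pairing_proj {A : Op X} (hA : 0 ≤ A) (ψ : Ell2 X) : pairing A (proj ψ) = quad A ψ := by
  rw [quad_eq hA, ← tsum_enorm_inner_sq (ketBasis X)]
  refine tsum_congr fun x => ?_
  rw [quad_proj, ketBasis_apply]
  nth_rw 1 [← root_adjoint A]
  rw [ContinuousLinearMap.adjoint_inner_left]

theorem pairing_one_left {B : Op X} (hB : 0 ≤ B) : pairing 1 B = hs (root B) := by
  rw [pairing_comm zero_le_one hB, pairing]
  exact tsum_congr fun x => quad_one _

theorem pairing_one_proj (ψ : Ell2 X) : pairing 1 (proj ψ) = ‖ψ‖ₑ ^ 2 := by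
  rw [pairing_proj zero_le_one, quad_one]

/-- A positive operator of trace at most one is at most the identity. -/
theorem le_one_of_pairing_le_one {B : Op X} (hB : 0 ≤ B) (h : pairing 1 B ≤ 1) : B ≤ 1 := by
  refine le_of_quad_le hB zero_le_one fun ψ => ?_
  rw [quad_eq hB, quad_one, ← tsum_enorm_inner_sq (ketBasis X)]
  calc ∑' x, ‖inner ℂ (ketBasis X x) (root B ψ)‖ₑ ^ 2
      ≤ ∑' x, ‖root B (ket x)‖ₑ ^ 2 * ‖ψ‖ₑ ^ 2 := by
        -- Cauchy-Schwarz in each coordinate `⟨√B x, ψ⟩`: the operator norm is at most the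
        -- Hilbert-Schmidt norm.
        refine ENNReal.tsum_le_tsum fun x => ?_
        nth_rw 1 [← root_adjoint B]
        rw [ContinuousLinearMap.adjoint_inner_right, ← mul_pow, ketBasis_apply]
        gcongr
        rw [← ofReal_norm, ← ofReal_norm, ← ofReal_norm, ← ENNReal.ofReal_mul (norm_nonneg _)]
        exact ENNReal.ofReal_le_ofReal (norm_inner_le_norm _ _)
    _ ≤ ‖ψ‖ₑ ^ 2 := by
        rw [ENNReal.tsum_mul_right]
        rw [pairing_one_left hB] at h
        exact mul_le_of_le_one_left' h

theorem hs_mul_le (A B : Op X) : hs (A * B) ≤ ‖A‖ₑ ^ 2 * hs B := by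
  rw [hs, hs, ← ENNReal.tsum_mul_left]
  refine ENNReal.tsum_le_tsum fun x => ?_
  rw [← mul_pow, mul_apply_eq_comp]
  gcongr
  exact A.le_opENorm _

theorem hs_mul_ne_top {A B : Op X} (hB : hs B ≠ ∞) : hs (A * B) ≠ ∞ :=
  ((hs_mul_le A B).trans_lt (ENNReal.mul_lt_top (by simp) hB.lt_top)).ne

theorem hs_mul_ne_top' {A B : Op X} (hA : hs A ≠ ∞) : hs (A * B) ≠ ∞ := by
  rw [← hs_adjoint, adjoint_mul]
  exact hs_mul_ne_top (by rwa [hs_adjoint])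

theorem hasSum_norm_sq_of_hs {ι : Type*} (b : HilbertBasis ι ℂ (Ell2 X)) {A : Op X}
    (hA : hs A ≠ ∞) : HasSum (fun i => ‖A (b i)‖ ^ 2) (hs A).toReal := by
  rw [← tsum_basis_eq_hs b] at hA ⊢
  have h := ENNReal.hasSum_toReal hA
  rw [ENNReal.tsum_toReal_eq (ENNReal.ne_top_of_tsum_ne_top hA)]
  simpa using h

/-- The constant is not sharp; only finiteness of sums of Hilbert-Schmidt operators depends on it.
-/
theorem add_sq_le_four_mul (a b : ℝ≥0∞) : (a + b) ^ 2 ≤ 4 * (a ^ 2 + b ^ 2) := by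
  rcases le_total a b with h | h
  · calc (a + b) ^ 2 ≤ (b + b) ^ 2 := by gcongr
      _ = 4 * b ^ 2 := by ring
      _ ≤ 4 * (a ^ 2 + b ^ 2) := by gcongr; exact le_add_self
  · calc (a + b) ^ 2 ≤ (a + a) ^ 2 := by gcongr
      _ = 4 * a ^ 2 := by ring
      _ ≤ 4 * (a ^ 2 + b ^ 2) := by gcongr; exact le_self_add

theorem hs_add_ne_top {A B : Op X} (hA : hs A ≠ ∞) (hB : hs B ≠ ∞) : hs (A + B) ≠ ∞ := by
  have h : hs (A + B) ≤ 4 * (hs A + hs B) := by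
    rw [hs, hs, hs, ← ENNReal.tsum_add, ← ENNReal.tsum_mul_left]
    refine ENNReal.tsum_le_tsum fun x => ?_
    have h1 : ‖(A + B) (ket x)‖ₑ ≤ ‖A (ket x)‖ₑ + ‖B (ket x)‖ₑ := enorm_add_le _ _
    calc ‖(A + B) (ket x)‖ₑ ^ 2 ≤ (‖A (ket x)‖ₑ + ‖B (ket x)‖ₑ) ^ 2 := by gcongr
      _ ≤ 4 * (‖A (ket x)‖ₑ ^ 2 + ‖B (ket x)‖ₑ ^ 2) := add_sq_le_four_mul _ _
  exact (h.trans_lt (by finiteness)).ne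

theorem hs_smul (c : ℂ) (A : Op X) : hs (c • A) = ‖c‖ₑ ^ 2 * hs A := by
  simp only [hs, smul_apply, enorm_smul, mul_pow, ENNReal.tsum_mul_left]

/-- The sum `∑ᵢ ⟨A bᵢ, B bᵢ⟩` for Hilbert-Schmidt operators, in terms of Hilbert-Schmidt norms. -/
theorem hasSum_inner_of_hs {ι : Type*} (b : HilbertBasis ι ℂ (Ell2 X)) {A B : Op X}
    (hA : hs A ≠ ∞) (hB : hs B ≠ ∞) :
    HasSum (fun i => inner ℂ (A (b i)) (B (b i)))
      ((((hs (A + B)).toReal : ℂ) - (hs (A - B)).toReal + (((hs (A - Complex.I • B)).toReal : ℂ) -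
        (hs (A + Complex.I • B)).toReal) * Complex.I) / 4) := by
  have hIB : hs (Complex.I • B) ≠ ∞ := by rw [hs_smul]; finiteness
  have hneg : ∀ C : Op X, hs C ≠ ∞ → hs (-C) ≠ ∞ := fun C hC => by
    rw [← neg_one_smul ℂ, hs_smul]; finiteness
  have h1 := (hasSum_norm_sq_of_hs b (hs_add_ne_top hA hB)).mapL Complex.ofRealCLM
  have h2 := (hasSum_norm_sq_of_hs b (hs_add_ne_top hA (hneg _ hB))).mapL Complex.ofRealCLM
  have h3 := (hasSum_norm_sq_of_hs b (hs_add_ne_top hA (hneg _ hIB))).mapL Complex.ofRealCLM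
  have h4 := (hasSum_norm_sq_of_hs b (hs_add_ne_top hA hIB)).mapL Complex.ofRealCLM
  simp only [← sub_eq_add_neg] at h2 h3
  have h := ((h1.sub h2).add ((h3.sub h4).mul_right Complex.I)).div_const 4
  refine h.congr_fun fun i => ?_
  -- Polarisation: each term is a combination of four squared norms, and each of these sums to a
  -- Hilbert-Schmidt norm, which does not depend on `b`.
  rw [inner_eq_sum_norm_sq_div_four]
  simp

/-- Cyclicity of the trace, `tr (A† B) = tr (B A†)`. The polarisation formula expresses each side by
four Hilbert-Schmidt norms, and these agree in pairs up to adjoints and factors of modulus one. -/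
theorem tsum_inner_adjoint {A B : Op X} (hA : hs A ≠ ∞) (hB : hs B ≠ ∞) :
    ∑' x, inner ℂ (A (ket x)) (B (ket x)) = ∑' x, inner ℂ ((B†) (ket x)) ((A†) (ket x)) := by
  have hI : ‖Complex.I‖ₑ = 1 := by rw [← ofReal_norm, Complex.norm_I, ENNReal.ofReal_one]
  have h1 := hasSum_inner_of_hs (ketBasis X) hA hB
  have h2 := hasSum_inner_of_hs (ketBasis X) (A := B†) (B := A†) (by rwa [hs_adjoint])
    (by rwa [hs_adjoint])
  have e1 : hs (B† + A†) = hs (A + B) := by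
    rw [← hs_adjoint (A + B), map_add, add_comm]
  have e2 : hs (B† - A†) = hs (A - B) := by
    have : B† - A† = (-1 : ℂ) • (A - B)† := by rw [map_sub]; simp
    rw [this, hs_smul, hs_adjoint]
    simp
  have e3 : hs (B† - Complex.I • A†) = hs (A - Complex.I • B) := by
    have : B† - Complex.I • A† = (-Complex.I) • (A - Complex.I • B)† := by
      rw [map_sub, map_smulₛₗ, smul_sub, smul_smul]
      simp [sub_eq_add_neg, add_comm]
    rw [this, hs_smul, hs_adjoint]
    simp [hI]
  have e4 : hs (B† + Complex.I • A†) = hs (A + Complex.I • B) := by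
    have : B† + Complex.I • A† = Complex.I • (A + Complex.I • B)† := by
      rw [map_add, map_smulₛₗ, smul_add, smul_smul]
      simp [add_comm]
    rw [this, hs_smul, hs_adjoint]
    simp [hI]
  rw [e1, e2, e3, e4] at h2
  exact h1.tsum_eq.trans h2.tsum_eq.symm

/-- Splits `P ρ` between `√ρ P` and `√ρ`, both Hilbert-Schmidt when `ρ` has finite trace. -/
theorem inner_mul_eq {P ρ : Op X} (hρ : 0 ≤ ρ) (hP : 0 ≤ P) (ψ : Ell2 X) :
    inner ℂ ψ ((P * ρ) ψ) = inner ℂ ((root ρ * P) ψ) (root ρ ψ) := by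
  nth_rw 1 [← root_mul_root hρ]
  simp only [mul_apply_eq_comp]
  rw [← ContinuousLinearMap.adjoint_inner_right, root_adjoint,
    ← ContinuousLinearMap.adjoint_inner_right, adjoint_eq_self hP]

theorem isTraceOp_mul {P ρ : Op X} (hP : 0 ≤ P) (hρ : 0 ≤ ρ) (h : pairing 1 ρ ≠ ∞) :
    IsTraceOp (P * ρ) := by
  rw [pairing_one_left hρ] at h
  intro ι b
  simp only [inner_mul_eq hρ hP]
  exact (hasSum_inner_of_hs b (hs_mul_ne_top' h) h).summable

theorem tr_mul_eq {P ρ : Op X} (hP : 0 ≤ P) (hρ : 0 ≤ ρ) (h : pairing 1 ρ ≠ ∞) :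
    tr (P * ρ) = (pairing P ρ).toReal := by
  rw [pairing_one_left hρ] at h
  have h2 : pairing P ρ ≠ ∞ := by
    rw [pairing_comm hP hρ, pairing_eq_hs _ hP]
    exact hs_mul_ne_top h
  simp only [tr, inner_mul_eq hρ hP]
  -- After the cyclic exchange the terms are `⟨√ρ x, P √ρ x⟩`, which are those of `pairing ρ P`.
  rw [tsum_inner_adjoint (hs_mul_ne_top' h) h]
  simp only [adjoint_mul, root_adjoint, adjoint_eq_self hP, mul_apply_eq_comp]
  rw [pairing_comm hP hρ, pairing] at h2 ⊢
  rw [ENNReal.tsum_toReal_eq (ENNReal.ne_top_of_tsum_ne_top h2), Complex.ofReal_tsum]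
  refine tsum_congr fun x => ?_
  have hi := Complex.nonneg_iff.1 (inner_nonneg hP (root ρ (ket x)))
  rw [quad, ENNReal.toReal_ofReal hi.1]
  exact Complex.ext rfl hi.2.symm

theorem isPartialDensity_iff {ρ : Op X} : IsPartialDensity ρ ↔ 0 ≤ ρ ∧ pairing 1 ρ ≤ 1 := by
  refine ⟨fun ⟨h0, h1, h2⟩ => ⟨h0, ?_⟩, fun ⟨h0, h1⟩ => ?_⟩
  · have hfin : pairing 1 ρ = ENNReal.ofReal (tr ρ).re := by
      -- Summability is essential here: a divergent diagonal would have `tr ρ = 0` by default.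
      have hs1 := Complex.hasSum_re (h1 X (ketBasis X)).hasSum
      have hpos : ∀ x, 0 ≤ (inner ℂ (ketBasis X x) (ρ (ketBasis X x))).re := fun x =>
        (Complex.nonneg_iff.1 (inner_nonneg h0 _)).1
      have e : (tr ρ).re = (∑' x, inner ℂ (ketBasis X x) (ρ (ketBasis X x))).re := rfl
      rw [e, ← hs1.tsum_eq, ENNReal.ofReal_tsum_of_nonneg hpos hs1.summable, pairing_one_left h0]
      exact tsum_congr fun x => (quad_eq h0 _).symm
    rw [hfin]
    exact ENNReal.ofReal_le_one.2 h2
  · have hne : pairing 1 ρ ≠ ∞ := (h1.trans_lt ENNReal.one_lt_top).ne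
    refine ⟨h0, ?_, ?_⟩
    · simpa using isTraceOp_mul zero_le_one h0 hne
    · have := tr_mul_eq zero_le_one h0 hne
      rw [one_mul] at this
      rw [this, Complex.ofReal_re]
      exact ENNReal.toReal_le_of_le_ofReal zero_le_one (by simpa using h1)

end Pairing

/-! ### Kraus families -/

section Kraus

variable {X : Type}

theorem IsPartialDensity.nonneg {ρ : Op X} (hρ : IsPartialDensity ρ) : 0 ≤ ρ := hρ.1

theorem IsPartialDensity.pairing_le {ρ : Op X} (hρ : IsPartialDensity ρ) : pairing 1 ρ ≤ 1 :=
  (isPartialDensity_iff.1 hρ).2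

theorem IsPartialDensity.pairing_ne_top {ρ : Op X} (hρ : IsPartialDensity ρ) :
    pairing 1 ρ ≠ ∞ := (hρ.pairing_le.trans_lt ENNReal.one_lt_top).ne

theorem IsPredicate.pairing_ne_top {P ρ : Op X} (hP : IsPredicate P) (hρ : IsPartialDensity ρ) :
    pairing P ρ ≠ ∞ :=
  ((pairing_mono_left hP.1 hρ.nonneg hP.2).trans_lt hρ.pairing_ne_top.lt_top).ne

theorem isPredicate_zero : IsPredicate (0 : Op X) := ⟨le_rfl, zero_le_one⟩

theorem isPredicate_one : IsPredicate (1 : Op X) := ⟨zero_le_one, le_rfl⟩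

/-- Positive operators with total trace at most one have a sum, a partial density operator. -/
theorem exists_hasOpSum_isPartialDensity {ι : Type*} {f : ι → Op X} (hf : ∀ i, 0 ≤ f i)
    (h : ∑' i, pairing 1 (f i) ≤ 1) : ∃ A, HasOpSum f A ∧ IsPartialDensity A := by
  obtain ⟨A, hA, hA0, -⟩ := exists_hasOpSum hf fun s => by
    -- The trace bound is used to obtain the weaker operator bound that strong summability requires.
    refine le_one_of_pairing_le_one (Finset.sum_nonneg fun i _ => hf i) ?_
    rw [pairing_finset_sum_right _ hf]
    exact (ENNReal.sum_le_tsum s).trans h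
  refine ⟨A, hA, isPartialDensity_iff.2 ⟨hA0, ?_⟩⟩
  rwa [pairing_hasOpSum_right _ hf hA]

/-- Moving the `K i` to the other side turns a finite partial sum into the pairing of `∑ (K i)† (K
i) ≤ 1` with `ρ`. -/
theorem tsum_pairing_conj_le {ι : Type*} {K : ι → Op X}
    (hK : ∀ s : Finset ι, ∑ i ∈ s, (K i)† * K i ≤ 1) {ρ : Op X} (hρ : 0 ≤ ρ) :
    ∑' i, pairing 1 (K i * ρ * (K i)†) ≤ pairing 1 ρ := by
  rw [ENNReal.tsum_eq_iSup_sum]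
  refine iSup_le fun s => ?_
  have hs := pairing_mono_left (Finset.sum_nonneg fun i _ => adjoint_mul_self_nonneg (K i))
    hρ (hK s)
  rw [pairing_finset_sum_left hρ (fun i => adjoint_mul_self_nonneg (K i))] at hs
  simpa only [← pairing_conj zero_le_one hρ, mul_one] using hs

theorem exists_hasOpSum_conj {ι : Type*} {K : ι → Op X}
    (hK : ∀ s : Finset ι, ∑ i ∈ s, (K i)† * K i ≤ 1) {ρ : Op X} (hρ : IsPartialDensity ρ) :
    ∃ A, HasOpSum (fun i => K i * ρ * (K i)†) A ∧ IsPartialDensity A :=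
  exists_hasOpSum_isPartialDensity (fun i => conj_nonneg hρ.nonneg (K i))
    ((tsum_pairing_conj_le hK hρ.nonneg).trans hρ.pairing_le)

theorem IsPartialDensity.conj {ι : Type*} {K : ι → Op X}
    (hK : ∀ s : Finset ι, ∑ i ∈ s, (K i)† * K i ≤ 1) {ρ : Op X} (hρ : IsPartialDensity ρ)
    (i : ι) : IsPartialDensity (K i * ρ * (K i)†) :=
  isPartialDensity_iff.2 ⟨conj_nonneg hρ.nonneg _,
    (ENNReal.le_tsum i).trans ((tsum_pairing_conj_le hK hρ.nonneg).trans hρ.pairing_le)⟩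

/-- `W` depends on `i` because each measurement outcome continues with its own program. The partial
sums are bounded by those of `(K i)† (K i)`. -/
theorem exists_hasOpSum_conj' {ι : Type*} {K W : ι → Op X}
    (hK : ∀ s : Finset ι, ∑ i ∈ s, (K i)† * K i ≤ 1) (hW : ∀ i, IsPredicate (W i)) :
    ∃ A, HasOpSum (fun i => (K i)† * W i * K i) A ∧ IsPredicate A := by
  obtain ⟨A, hA, h⟩ := exists_hasOpSum (fun i => conj_nonneg' (hW i).1 (K i)) fun s => by
    refine (Finset.sum_le_sum fun i _ => conj_mono' (hW i).2 (K i)).trans ?_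
    simpa using hK s
  exact ⟨A, hA, h⟩

theorem pairing_hasOpSum_conj {ι : Type*} {K W : ι → Op X} (hW : ∀ i, 0 ≤ W i) {A : Op X}
    (hA : HasOpSum (fun i => (K i)† * W i * K i) A) {ρ : Op X} (hρ : 0 ≤ ρ) :
    pairing A ρ = ∑' i, pairing (W i) (K i * ρ * (K i)†) := by
  rw [pairing_hasOpSum_left hρ (fun i => conj_nonneg' (hW i) (K i)) hA]
  exact tsum_congr fun i => pairing_conj (hW i) hρ (K i)

/-- Bessel's inequality. The injection `g` allows the sum to run over the values of one variable
while the kets are labelled by the one-variable register. -/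
theorem sum_ketBra_le_one {ι Y : Type} {g : ι → Y} (hg : g.Injective) (s : Finset ι) :
    ∑ i ∈ s, ketBra (g i) (g i) ≤ 1 := by
  have h0 : ∀ i, 0 ≤ ketBra (g i) (g i) := fun i => proj_nonneg (ket (g i))
  refine le_of_quad_le (Finset.sum_nonneg fun i _ => h0 i) zero_le_one fun ψ => ?_
  rw [quad_finset_sum h0, quad_one, ← tsum_enorm_inner_sq (ketBasis Y)]
  refine (ENNReal.sum_le_tsum s).trans ?_
  refine le_trans (le_of_eq ?_) (ENNReal.tsum_comp_le_tsum_of_injective hg _)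
  refine tsum_congr fun i => ?_
  have h := quad_proj (ket (g i)) ψ
  rw [← inner_conj_symm, RCLike.enorm_conj] at h
  exact h

theorem ketBra_mul_ketBra {Y : Type} (x y z : Y) : ketBra x y * ketBra y z = ketBra x z := by
  ext1 ψ
  have h : ‖ket y‖ = 1 := (ketBasis Y).orthonormal.1 y
  simp [ketBra, mul_apply_eq_comp, InnerProductSpace.rankOne_apply, h]

theorem ketBra_adjoint {Y : Type} (x y : Y) : (ketBra x y)† = ketBra y x := by
  symm
  rw [ContinuousLinearMap.eq_adjoint_iff]
  intro φ ψ
  simp [ketBra, InnerProductSpace.rankOne_apply, inner_smul_left, inner_smul_right, mul_comm]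

theorem sum_bool_le {K : Bool → Op X} (h : (K false)† * K false + (K true)† * K true = 1)
    (s : Finset Bool) : ∑ b ∈ s, (K b)† * K b ≤ 1 := by
  rw [← h, add_comm, ← Fintype.sum_bool fun b => (K b)† * K b]
  exact Finset.sum_le_sum_of_subset_of_nonneg s.subset_univ
    fun b _ _ => adjoint_mul_self_nonneg (K b)

theorem sum_unit_le {K : Op X} (h : K† * K = 1) (s : Finset Unit) :
    ∑ _b ∈ s, K† * K ≤ 1 := by
  rw [← h]
  calc ∑ _b ∈ s, K† * K ≤ ∑ _b : Unit, K† * K :=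
        Finset.sum_le_sum_of_subset_of_nonneg s.subset_univ fun _ _ _ => adjoint_mul_self_nonneg K
    _ = K† * K := by simp

end Kraus

/-! ### Algebraic properties of cylinder extensions -/

section Cyl

variable {Var : Type} {ty : Var → Ty} (B : GlobalBasis ty) {n : ℕ} (qs : Fin n ↪ Var)

/-- The cylinder extension is a direct sum of copies of `A`, one for each assignment to the other
variables; the inner product is regrouped along `splitEquiv`. -/
theorem hasSum_inner_cyl (A : RegOp ty qs) (φ ψ : Ell2 B.Label) :
    HasSum (fun e : EnvLabel B qs => inner ℂ (slice B qs e.1 φ) (A (slice B qs e.1 ψ)))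
      (inner ℂ φ (cyl B qs A ψ)) := by
  have h := (splitEquiv B qs).symm.hasSum_iff.2 
    (lp.hasSum_inner (𝕜 := ℂ) (G := fun _ : B.Label => ℂ) φ (cyl B qs A ψ))
  refine h.prod_fiberwise fun e => ?_
  refine (lp.hasSum_inner (𝕜 := ℂ) (G := fun _ : RegLabel ty qs => ℂ) (slice B qs e.1 φ)
    (A (slice B qs e.1 ψ))).congr_fun fun s => ?_
  have : (splitEquiv B qs).symm (e, s) = patch B qs e.1 s := rfl
  rw [Function.comp_apply, this, cyl_apply, slice_patch, restrict_patch]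
  rfl

theorem cyl_adjoint (A : RegOp ty qs) : (cyl B qs A)† = cyl B qs (A†) := by
  symm
  rw [ContinuousLinearMap.eq_adjoint_iff]
  intro φ ψ
  have h1 := hasSum_inner_cyl B qs A φ ψ
  have h2 := Complex.hasSum_conj'.2 (hasSum_inner_cyl B qs (A†) ψ φ)
  simp only [inner_conj_symm, ContinuousLinearMap.adjoint_inner_left] at h2
  exact h2.unique h1

theorem slice_cyl (A : RegOp ty qs) (σ : B.Label) (ψ : Ell2 B.Label) :
    slice B qs σ (cyl B qs A ψ) = A (slice B qs σ ψ) := by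
  apply lp.ext
  funext s
  change cyl B qs A ψ (patch B qs σ s) = _
  rw [cyl_apply, slice_patch, restrict_patch]

theorem cyl_mul (A A' : RegOp ty qs) : cyl B qs (A * A') = cyl B qs A * cyl B qs A' := by
  ext1 ψ
  apply lp.ext
  funext σ
  rw [mul_apply_eq_comp, cyl_apply, cyl_apply, slice_cyl, mul_apply_eq_comp]

theorem cyl_one : cyl B qs 1 = 1 := by
  ext1 ψ
  apply lp.ext
  funext σ
  rw [cyl_apply]
  change ψ.1 (patch B qs σ (restrict B qs σ)) = ψ.1 σ
  rw [patch_restrict]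

theorem cyl_add (A A' : RegOp ty qs) : cyl B qs (A + A') = cyl B qs A + cyl B qs A' := rfl

theorem cyl_sum {ι : Type*} (f : ι → RegOp ty qs) (s : Finset ι) :
    cyl B qs (∑ i ∈ s, f i) = ∑ i ∈ s, cyl B qs (f i) :=
  map_sum (AddMonoidHom.mk' (cyl B qs) (cyl_add B qs)) f s

/-- `cyl` respects products and adjoints, so it carries `√A† √A` to an operator of the form `K† K`.
-/
theorem cyl_nonneg {A : RegOp ty qs} (hA : 0 ≤ A) : 0 ≤ cyl B qs A := by
  have h : (cyl B qs (root A))† * cyl B qs (root A) = cyl B qs A := by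
    rw [cyl_adjoint, ← cyl_mul, root_adjoint, root_mul_root hA]
  rw [← h]
  exact adjoint_mul_self_nonneg _

theorem cyl_mono {A A' : RegOp ty qs} (h : A ≤ A') : cyl B qs A ≤ cyl B qs A' := by
  have h2 := cyl_nonneg B qs (sub_nonneg.2 h)
  have h3 := cyl_add B qs (A' - A) A
  rw [sub_add_cancel] at h3
  rw [h3]
  exact le_add_of_nonneg_left h2

/-- Only finite sums pass through `cyl`, so its continuity in the strong operator topology is not
needed. -/
theorem sum_cyl_adjoint_mul_self_le {ι : Type*} {M : ι → RegOp ty qs}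
    (hM : ∀ s : Finset ι, ∑ i ∈ s, (M i)† * M i ≤ 1) (s : Finset ι) :
    ∑ i ∈ s, (cyl B qs (M i))† * cyl B qs (M i) ≤ 1 := by
  have h := cyl_mono B qs (hM s)
  simpa only [cyl_one, cyl_sum, cyl_mul, ← cyl_adjoint] using h

theorem sum_le_of_hasOpSum {X : Type} {ι : Type*} {f : ι → Op X} {A : Op X}
    (hf : ∀ i, 0 ≤ f i) (hA : HasOpSum f A) (s : Finset ι) : ∑ i ∈ s, f i ≤ A := by
  refine le_of_quad_le (Finset.sum_nonneg fun i _ => hf i) (hA.nonneg hf) fun ψ => ?_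
  rw [quad_finset_sum hf, hA.quad_eq_tsum hf]
  exact ENNReal.sum_le_tsum s

theorem sum_cyl_measure_le {ι : Type*} {M : ι → RegOp ty qs}
    (hM : HasOpSum (fun m => (M m)† * M m) 1) (s : Finset ι) :
    ∑ i ∈ s, (cyl B qs (M i))† * cyl B qs (M i) ≤ 1 :=
  sum_cyl_adjoint_mul_self_le B qs
    (sum_le_of_hasOpSum (fun i => adjoint_mul_self_nonneg (M i)) hM) s

theorem cyl_loop {M₀ M₁ : RegOp ty qs} (hM : M₀† * M₀ + M₁† * M₁ = 1) :
    (cyl B qs M₀)† * cyl B qs M₀ + (cyl B qs M₁)† * cyl B qs M₁ = 1 := by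
  rw [cyl_adjoint, cyl_adjoint, ← cyl_mul, ← cyl_mul, ← cyl_add, hM, cyl_one]

theorem ketBraAt_adjoint (q : Var) (v w : (ty q).Val) :
    (ketBraAt B q v w)† = ketBraAt B q w v := by
  rw [ketBraAt, cyl_adjoint, ketBra_adjoint, ketBraAt]

theorem sum_ketBraAt_le (q : Var) (w : (ty q).Val) (s : Finset (ty q).Val) :
    ∑ v ∈ s, (ketBraAt B q w v)† * ketBraAt B q w v ≤ 1 := by
  refine sum_cyl_adjoint_mul_self_le B (single q)
    (M := fun v => ketBra (singleLabel q w) (singleLabel q v)) (fun s => ?_) s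
  simp only [ketBra_adjoint, ketBra_mul_ketBra]
  exact sum_ketBra_le_one (g := singleLabel q) (fun v v' h => congrFun h 0) s

end Cyl

/-! ### Terminating computations -/

section Runs

variable {Var : Type} {ty : Var → Ty} {B : GlobalBasis ty}

theorem Step.isPartialDensity {C C' : Option (Prog ty)} {ρ ρ' : GOp B} (t : Step B C ρ C' ρ')
    (hρ : IsPartialDensity ρ) : IsPartialDensity ρ' := by
  induction t with
  | skip ρ => exact hρ
  | init q ρ =>
    obtain ⟨A, hA, hA'⟩ := exists_hasOpSum_conj (sum_ketBraAt_le B q (ty q).zero) hρ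
    simp only [ketBraAt_adjoint] at hA
    rwa [hA.opSum_eq]
  | unitary qs U hU ρ =>
    exact hρ.conj (sum_unit_le (by rw [cyl_adjoint, ← cyl_mul, hU, cyl_one])) ()
  | seq S₂ _ ih => exact ih hρ
  | seqE S₂ _ ih => exact ih hρ
  | measure qs M hM S ρ m => exact hρ.conj (sum_cyl_measure_le B qs hM) m
  | loop₀ qs M₀ M₁ hM S ρ =>
    exact hρ.conj (K := fun b => bif b then cyl B qs M₁ else cyl B qs M₀)
      (sum_bool_le (cyl_loop B qs hM)) false
  | loop₁ qs M₀ M₁ hM S ρ =>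
    exact hρ.conj (K := fun b => bif b then cyl B qs M₁ else cyl B qs M₀)
      (sum_bool_le (cyl_loop B qs hM)) true

theorem Run.isPartialDensity {C : Option (Prog ty)} {ρ ρ' : GOp B} (r : Run B C ρ ρ')
    (hρ : IsPartialDensity ρ) : IsPartialDensity ρ' := by
  induction r with
  | done ρ => exact hρ
  | step t _ ih => exact ih (t.isPartialDensity hρ)

/-- The number of transitions of a computation. -/
def Run.length {C : Option (Prog ty)} {ρ ρ' : GOp B} : Run B C ρ ρ' → ℕ
  | .done _ => 0
  | .step _ r => r.length + 1

/-- The transitions from `⟨S, ρ⟩`. -/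
abbrev StepFrom (B : GlobalBasis ty) (S : Prog ty) (ρ : GOp B) : Type 1 :=
  Σ (C' : Option (Prog ty)) (ρ' : GOp B), Step B (some S) ρ C' ρ'

/-- The terminating computations from `⟨C, ρ⟩`. -/
abbrev RunFrom (B : GlobalBasis ty) (C : Option (Prog ty)) (ρ : GOp B) : Type 1 :=
  Σ ρ' : GOp B, Run B C ρ ρ'

/-- A terminating computation of a program is a transition followed by a computation. -/
def runFromEquiv (S : Prog ty) (ρ : GOp B) :
    RunFrom B (some S) ρ ≃ Σ t : StepFrom B S ρ, RunFrom B t.1 t.2.1 where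
  toFun
    | ⟨_, .step t r⟩ => ⟨⟨_, _, t⟩, ⟨_, r⟩⟩
  invFun c := ⟨c.2.1, .step c.1.2.2 c.2.2⟩
  left_inv := by rintro ⟨_, _ | _⟩; rfl
  right_inv _ := rfl

instance runFromNoneUnique (ρ : GOp B) : Unique (RunFrom B none ρ) where
  default := ⟨ρ, .done ρ⟩
  uniq := by rintro ⟨_, _ | _⟩; rfl

instance stepFromSkipUnique (ρ : GOp B) : Unique (StepFrom B .skip ρ) where
  default := ⟨_, _, .skip ρ⟩
  uniq := by rintro ⟨_, _, _ | _⟩; rfl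

noncomputable instance stepFromInitUnique (q : Var) (ρ : GOp B) : Unique (StepFrom B (.init q) ρ) where
  default := ⟨_, _, .init q ρ⟩
  uniq := by rintro ⟨_, _, _ | _⟩; rfl

noncomputable instance stepFromUnitaryUnique {n : ℕ} (qs : Fin n ↪ Var) (U : RegOp ty qs) (hU : U† * U = 1)
    (ρ : GOp B) : Unique (StepFrom B (.unitary qs U hU) ρ) where
  default := ⟨_, _, .unitary qs U hU ρ⟩
  uniq := by rintro ⟨_, _, _ | _⟩; rfl

/-- The transitions of a measurement correspond to its outcomes. -/
noncomputable def stepFromMeasureEquiv {n : ℕ} (qs : Fin n ↪ Var) {ι : Type} (M : ι → RegOp ty qs)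
    (hM : HasOpSum (fun m => (M m)† * M m) 1) (S : ι → Prog ty) (ρ : GOp B) :
    ι ≃ StepFrom B (.measure qs M hM S) ρ where
  toFun m := ⟨_, _, .measure qs M hM S ρ m⟩
  invFun
    | ⟨_, _, .measure _ _ _ _ _ m⟩ => m
  left_inv _ := rfl
  right_inv := by rintro ⟨_, _, _ | _⟩; rfl

/-- The two transitions of a loop. -/
noncomputable def stepFromLoopEquiv {n : ℕ} (qs : Fin n ↪ Var) (M₀ M₁ : RegOp ty qs)
    (hM : M₀† * M₀ + M₁† * M₁ = 1) (S : Prog ty) (ρ : GOp B) :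
    Bool ≃ StepFrom B (.loop qs M₀ M₁ hM S) ρ where
  toFun
    | false => ⟨_, _, .loop₀ qs M₀ M₁ hM S ρ⟩
    | true => ⟨_, _, .loop₁ qs M₀ M₁ hM S ρ⟩
  invFun
    | ⟨_, _, .loop₀ _ _ _ _ _ _⟩ => false
    | ⟨_, _, .loop₁ _ _ _ _ _ _⟩ => true
  left_inv := by rintro (_ | _) <;> rfl
  right_inv := by rintro ⟨_, _, _ | _⟩ <;> rfl

/-- `C; S₂`, with the convention `E; S₂ = S₂`. -/
def andThen (C : Option (Prog ty)) (S₂ : Prog ty) : Prog ty :=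
  C.elim S₂ fun S₁ => .seq S₁ S₂

/-- The transitions of `S₁; S₂` correspond to those of `S₁`. -/
def stepFromSeqEquiv (S₁ S₂ : Prog ty) (ρ : GOp B) :
    StepFrom B S₁ ρ ≃ StepFrom B (.seq S₁ S₂) ρ where
  toFun
    | ⟨none, _, t⟩ => ⟨_, _, .seqE S₂ t⟩
    | ⟨some _, _, t⟩ => ⟨_, _, .seq S₂ t⟩
  invFun
    | ⟨_, _, .seq _ t⟩ => ⟨_, _, t⟩
    | ⟨_, _, .seqE _ t⟩ => ⟨_, _, t⟩
  left_inv := by rintro ⟨_ | _, _, _⟩ <;> rfl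
  right_inv := by rintro ⟨_, _, _ | _⟩ <;> rfl

/-- The arbitrary `F` reads off target program and state together, which avoids rewriting inside a
dependent pair. -/
theorem stepFromSeqEquiv_apply {S₁ : Prog ty} (S₂ : Prog ty) {ρ : GOp B} (t : StepFrom B S₁ ρ)
    (F : Option (Prog ty) → GOp B → ℝ≥0∞) :
    F (stepFromSeqEquiv S₁ S₂ ρ t).1 (stepFromSeqEquiv S₁ S₂ ρ t).2.1 =
      F (some (andThen t.1 S₂)) t.2.1 := by
  obtain ⟨_ | _, _, _⟩ := t <;> rfl

theorem tsum_eq_default {α : Type*} [Unique α] (f : α → ℝ≥0∞) : ∑' a, f a = f default := by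
  rw [tsum_fintype, Fintype.sum_unique]

/-- The sum of the values of `f` at the final states of all terminating computations. -/
noncomputable def runTotal (C : Option (Prog ty)) (ρ : GOp B) (f : GOp B → ℝ≥0∞) : ℝ≥0∞ :=
  ∑' c : RunFrom B C ρ, f c.1

/-- The sum of the values of `f` at the final states of the computations with at most `k`
transitions. -/
noncomputable def runSum (f : GOp B → ℝ≥0∞) : ℕ → Option (Prog ty) → GOp B → ℝ≥0∞
  | _, none, ρ => f ρ
  | 0, some _, _ => 0
  | k + 1, some S, ρ => ∑' t : StepFrom B S ρ, runSum f k t.1 t.2.1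

theorem runSum_none (f : GOp B → ℝ≥0∞) (k : ℕ) (ρ : GOp B) : runSum f k none ρ = f ρ := by
  cases k <;> rfl

theorem runTotal_none (ρ : GOp B) (f : GOp B → ℝ≥0∞) : runTotal none ρ f = f ρ := by
  rw [runTotal, tsum_eq_default]
  rfl

theorem runTotal_some (S : Prog ty) (ρ : GOp B) (f : GOp B → ℝ≥0∞) :
    runTotal (some S) ρ f = ∑' t : StepFrom B S ρ, runTotal t.1 t.2.1 f := by
  simp only [runTotal]
  rw [← (runFromEquiv S ρ).symm.tsum_eq, ENNReal.tsum_sigma']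
  rfl

theorem runSum_le_runTotal (f : GOp B → ℝ≥0∞) (k : ℕ) (C : Option (Prog ty)) (ρ : GOp B) :
    runSum f k C ρ ≤ runTotal C ρ f := by
  induction k generalizing C ρ with
  | zero =>
    cases C with
    | none => exact (runTotal_none ρ f).ge
    | some S => exact zero_le
  | succ k ih =>
    cases C with
    | none => exact (runTotal_none ρ f).ge
    | some S =>
      rw [runTotal_some]
      exact ENNReal.tsum_le_tsum fun t => ih t.1 t.2.1

theorem tsum_length_le_runSum (f : GOp B → ℝ≥0∞) (k : ℕ) (C : Option (Prog ty)) (ρ : GOp B) :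
    ∑' c : RunFrom B C ρ, (if c.2.length ≤ k then f c.1 else 0) ≤ runSum f k C ρ := by
  induction k generalizing C ρ with
  | zero =>
    cases C with
    | none => rw [tsum_eq_default]; exact le_rfl
    | some S =>
      refine (ENNReal.tsum_eq_zero.2 ?_).le
      rintro ⟨_, _ | ⟨t, r⟩⟩
      simp [Run.length]
  | succ k ih =>
    cases C with
    | none => rw [tsum_eq_default]; exact le_rfl
    | some S =>
      rw [← (runFromEquiv S ρ).symm.tsum_eq, ENNReal.tsum_sigma']
      refine ENNReal.tsum_le_tsum fun t => le_trans (le_of_eq ?_) (ih t.1 t.2.1)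
      refine tsum_congr fun c => ?_
      simp [runFromEquiv, Run.length]

/-- A finite set of computations has bounded length, so every finite partial sum is below some
`runSum`. Upper bounds on totals can thus be proved by induction on the length. -/
theorem runTotal_le {f : GOp B → ℝ≥0∞} {C : Option (Prog ty)} {ρ : GOp B} {a : ℝ≥0∞}
    (h : ∀ k, runSum f k C ρ ≤ a) : runTotal C ρ f ≤ a := by
  rw [runTotal, ENNReal.tsum_eq_iSup_sum]
  refine iSup_le fun s => ?_
  refine le_trans ?_ ((tsum_length_le_runSum f (s.sup fun c => c.2.length) C ρ).trans (h _))
  refine le_trans (Finset.sum_le_sum fun c hc => ?_) (ENNReal.sum_le_tsum s)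
  rw [if_pos (Finset.le_sup (f := fun c : RunFrom B C ρ => c.2.length) hc)]

theorem runTotal_mono {f g : GOp B → ℝ≥0∞} {C : Option (Prog ty)} {ρ : GOp B}
    (hρ : IsPartialDensity ρ) (h : ∀ ρ', IsPartialDensity ρ' → f ρ' ≤ g ρ') :
    runTotal C ρ f ≤ runTotal C ρ g :=
  ENNReal.tsum_le_tsum fun c => h _ (c.2.isPartialDensity hρ)

theorem runTotal_congr {f g : GOp B → ℝ≥0∞} {C : Option (Prog ty)} {ρ : GOp B}
    (hρ : IsPartialDensity ρ) (h : ∀ ρ', IsPartialDensity ρ' → f ρ' = g ρ') :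
    runTotal C ρ f = runTotal C ρ g :=
  tsum_congr fun c => h _ (c.2.isPartialDensity hρ)

theorem runSum_le_succ (f : GOp B → ℝ≥0∞) (k : ℕ) (C : Option (Prog ty)) (ρ : GOp B) :
    runSum f k C ρ ≤ runSum f (k + 1) C ρ := by
  induction k generalizing C ρ with
  | zero =>
    cases C with
    | none => exact le_rfl
    | some S => exact zero_le
  | succ k ih =>
    cases C with
    | none => exact le_rfl
    | some S => exact ENNReal.tsum_le_tsum fun t => ih t.1 t.2.1

theorem runSum_andThen_le (S₂ : Prog ty) (f : GOp B → ℝ≥0∞) (k : ℕ) (C : Option (Prog ty))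
    (ρ : GOp B) :
    runSum f k (some (andThen C S₂)) ρ ≤ runTotal C ρ fun ρ' => runSum f k (some S₂) ρ' := by
  induction k generalizing C ρ with
  | zero => exact zero_le
  | succ k ih =>
    cases C with
    | none => rw [runTotal_none]; exact le_rfl
    | some S₁ =>
      change ∑' t : StepFrom B (.seq S₁ S₂) ρ, runSum f k t.1 t.2.1 ≤ _
      rw [runTotal_some, ← (stepFromSeqEquiv S₁ S₂ ρ).tsum_eq]
      refine ENNReal.tsum_le_tsum fun t => ?_
      rw [stepFromSeqEquiv_apply S₂ t (runSum f k)]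
      -- The first transition leaves a budget of `k` for `S₂`, which may be raised to `k + 1`.
      exact (ih t.1 t.2.1).trans (ENNReal.tsum_le_tsum fun c => runSum_le_succ _ _ _ _)

theorem runSum_le_runTotal_andThen (S₂ : Prog ty) (f : GOp B → ℝ≥0∞) (k : ℕ)
    (C : Option (Prog ty)) (ρ : GOp B) :
    runSum (fun ρ' => runTotal (some S₂) ρ' f) k C ρ ≤ runTotal (some (andThen C S₂)) ρ f := by
  induction k generalizing C ρ with
  | zero =>
    cases C with
    | none => exact le_rfl
    | some S => exact zero_le
  | succ k ih =>
    cases C with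
    | none => exact le_rfl
    | some S₁ =>
      change _ ≤ runTotal (some (.seq S₁ S₂)) ρ f
      rw [runTotal_some, ← (stepFromSeqEquiv S₁ S₂ ρ).tsum_eq]
      refine ENNReal.tsum_le_tsum fun t => ?_
      rw [stepFromSeqEquiv_apply S₂ t fun C ρ => runTotal C ρ f]
      exact ih t.1 t.2.1

/-- A computation of `S₁; S₂` is a computation of `S₁` followed by one of `S₂`. Two inequalities
between length-bounded sums replace an explicit bijection: one truncates the whole computation, the
other only its first phase. -/
theorem runTotal_seq (S₁ S₂ : Prog ty) (ρ : GOp B) (f : GOp B → ℝ≥0∞) :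
    runTotal (some (.seq S₁ S₂)) ρ f =
      runTotal (some S₁) ρ fun ρ' => runTotal (some S₂) ρ' f := by
  refine le_antisymm (runTotal_le fun k => ?_)
    (runTotal_le fun k => runSum_le_runTotal_andThen S₂ f k (some S₁) ρ)
  exact (runSum_andThen_le S₂ f k (some S₁) ρ).trans
    (ENNReal.tsum_le_tsum fun c => runSum_le_runTotal _ _ _ _)

theorem runTotal_skip (ρ : GOp B) (f : GOp B → ℝ≥0∞) : runTotal (some .skip) ρ f = f ρ := by
  rw [runTotal_some, tsum_eq_default]
  exact runTotal_none ρ f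

theorem runTotal_init (q : Var) (ρ : GOp B) (f : GOp B → ℝ≥0∞) :
    runTotal (some (.init q)) ρ f =
      f (opSum fun v : (ty q).Val =>
        ketBraAt B q (ty q).zero v * ρ * ketBraAt B q v (ty q).zero) := by
  rw [runTotal_some, tsum_eq_default]
  exact runTotal_none _ f

theorem runTotal_unitary {n : ℕ} (qs : Fin n ↪ Var) (U : RegOp ty qs) (hU : U† * U = 1)
    (ρ : GOp B) (f : GOp B → ℝ≥0∞) :
    runTotal (some (.unitary qs U hU)) ρ f = f (cyl B qs U * ρ * (cyl B qs U)†) := by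
  rw [runTotal_some, tsum_eq_default]
  exact runTotal_none _ f

theorem runTotal_measure {n : ℕ} (qs : Fin n ↪ Var) {ι : Type} (M : ι → RegOp ty qs)
    (hM : HasOpSum (fun m => (M m)† * M m) 1) (S : ι → Prog ty) (ρ : GOp B)
    (f : GOp B → ℝ≥0∞) :
    runTotal (some (.measure qs M hM S)) ρ f =
      ∑' m, runTotal (some (S m)) (cyl B qs (M m) * ρ * (cyl B qs (M m))†) f := by
  rw [runTotal_some, ← (stepFromMeasureEquiv qs M hM S ρ).tsum_eq]
  rfl

theorem runTotal_loop {n : ℕ} (qs : Fin n ↪ Var) (M₀ M₁ : RegOp ty qs)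
    (hM : M₀† * M₀ + M₁† * M₁ = 1) (S : Prog ty) (ρ : GOp B) (f : GOp B → ℝ≥0∞) :
    runTotal (some (.loop qs M₀ M₁ hM S)) ρ f =
      f (cyl B qs M₀ * ρ * (cyl B qs M₀)†) +
      runTotal (some S) (cyl B qs M₁ * ρ * (cyl B qs M₁)†) fun ρ' =>
        runTotal (some (.loop qs M₀ M₁ hM S)) ρ' f := by
  rw [runTotal_some, ← (stepFromLoopEquiv qs M₀ M₁ hM S ρ).tsum_eq, tsum_bool, ← runTotal_seq]
  congr 1
  exact runTotal_none _ f

theorem runSum_loop_le {n : ℕ} (qs : Fin n ↪ Var) (M₀ M₁ : RegOp ty qs)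
    (hM : M₀† * M₀ + M₁† * M₁ = 1) (S : Prog ty) (ρ : GOp B) (f : GOp B → ℝ≥0∞) (k : ℕ) :
    runSum f (k + 1) (some (.loop qs M₀ M₁ hM S)) ρ ≤
      f (cyl B qs M₀ * ρ * (cyl B qs M₀)†) +
      runTotal (some S) (cyl B qs M₁ * ρ * (cyl B qs M₁)†) fun ρ' =>
        runSum f k (some (.loop qs M₀ M₁ hM S)) ρ' := by
  change ∑' t : StepFrom B (.loop qs M₀ M₁ hM S) ρ, runSum f k t.1 t.2.1 ≤ _
  rw [← (stepFromLoopEquiv qs M₀ M₁ hM S ρ).tsum_eq, tsum_bool]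
  refine add_le_add (runSum_none f k _).le ?_
  exact runSum_andThen_le (.loop qs M₀ M₁ hM S) f k (some S) _

end Runs

/-! ### Comparison of positive operators through the trace pairing -/

section Comparison

variable {X : Type}

theorem quad_smul (A : Op X) (c : ℂ) (ψ : Ell2 X) : quad A (c • ψ) = ‖c‖ₑ ^ 2 * quad A ψ := by
  have h : inner ℂ (c • ψ) (A (c • ψ)) = ((‖c‖ ^ 2 : ℝ) : ℂ) * inner ℂ ψ (A ψ) := by
    rw [map_smul, inner_smul_left, inner_smul_right, ← mul_assoc, Complex.conj_mul']
    norm_cast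
  rw [quad, h, Complex.re_ofReal_mul, ENNReal.ofReal_mul (by positivity),
    ENNReal.ofReal_pow (norm_nonneg _), ofReal_norm]
  rfl

/-- For `‖φ‖ ≤ 1` the operator `proj φ` is a partial density operator and tests the quadratic forms
at `φ`; other vectors are reached by scaling. -/
theorem le_of_pairing_le {A A' : Op X} (hA : 0 ≤ A) (hA' : 0 ≤ A')
    (h : ∀ ρ, IsPartialDensity ρ → pairing A ρ ≤ pairing A' ρ) : A ≤ A' := by
  have h1 : ∀ φ : Ell2 X, ‖φ‖ ≤ 1 → quad A φ ≤ quad A' φ := fun φ hφ => by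
    rw [← pairing_proj hA, ← pairing_proj hA']
    refine h _ (isPartialDensity_iff.2 ⟨proj_nonneg φ, ?_⟩)
    rw [pairing_one_proj, ← ofReal_norm, ← ENNReal.ofReal_pow (norm_nonneg _)]
    exact ENNReal.ofReal_le_one.2 (pow_le_one₀ (norm_nonneg _) hφ)
  refine le_of_quad_le hA hA' fun ψ => ?_
  by_cases hψ : ψ = 0
  · simp [hψ, quad]
  · have hn : (‖ψ‖ : ℂ) ≠ 0 := by simpa using hψ
    have hψ' : ψ = (‖ψ‖ : ℂ) • (‖ψ‖ : ℂ)⁻¹ • ψ := (smul_inv_smul₀ hn ψ).symm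
    rw [hψ', quad_smul, quad_smul A']
    gcongr
    refine h1 _ ?_
    rw [norm_smul, norm_inv, Complex.norm_real, norm_norm, inv_mul_cancel₀ (by simpa using hψ)]

/-- An increasing sequence of predicates that starts at `0` has a supremum, and the trace pairing
is continuous along the sequence. -/
theorem exists_isLUB {P : ℕ → Op X} (h0 : P 0 = 0) (hP : Monotone P) (h1 : ∀ k, P k ≤ 1) :
    ∃ A, IsPredicate A ∧ IsLUB (Set.range P) A ∧
      ∀ ρ, 0 ≤ ρ → pairing A ρ = ⨆ k, pairing (P k) ρ := by
  -- The supremum is built as the strong sum of the increments, so additivity of the pairing yields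
  -- its continuity along the sequence.
  have hf : ∀ k, 0 ≤ P (k + 1) - P k := fun k => sub_nonneg.2 (hP k.le_succ)
  have hsum : ∀ n, ∑ k ∈ Finset.range n, (P (k + 1) - P k) = P n := fun n => by
    rw [Finset.sum_range_sub, h0, sub_zero]
  obtain ⟨A, hA, hA01⟩ := exists_hasOpSum hf fun s => by
    obtain ⟨n, hn⟩ := s.exists_nat_subset_range
    exact (Finset.sum_le_sum_of_subset_of_nonneg hn fun k _ _ => hf k).trans
      ((hsum n).le.trans (h1 n))
  refine ⟨A, hA01, ⟨?_, fun C hC => ?_⟩, fun ρ hρ => ?_⟩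
  · rintro _ ⟨n, rfl⟩
    rw [← hsum n]
    exact sum_le_of_hasOpSum hf hA _
  · have hC0 : 0 ≤ C := h0.ge.trans (hC ⟨0, rfl⟩)
    refine le_of_quad_le hA01.1 hC0 fun ψ => ?_
    rw [hA.quad_eq_tsum hf, ENNReal.tsum_eq_iSup_nat]
    refine iSup_le fun n => ?_
    rw [← quad_finset_sum hf, hsum]
    exact quad_mono (hC ⟨n, rfl⟩) ψ
  · rw [pairing_hasOpSum_left hρ hf hA, ENNReal.tsum_eq_iSup_nat]
    refine iSup_congr fun n => ?_
    rw [← pairing_finset_sum_left hρ hf, hsum]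

end Comparison

/-! ### Dual predicates and weakest preconditions -/

section Dual

variable {Var : Type} {ty : Var → Ty} {B : GlobalBasis ty}

/-- `W` is a predicate whose value at each state `ρ` is the total value of `P` at the final states
of the computations of `S` that start in `ρ`. -/
def IsDual (B : GlobalBasis ty) (S : Prog ty) (P W : GOp B) : Prop :=
  IsPredicate W ∧ ∀ ρ, IsPartialDensity ρ → runTotal (some S) ρ (pairing P) = pairing W ρ

/-- A dual of `1` gives the total trace of the final states as `pairing W ρ`, which is at most `tr
ρ` because `W ≤ 1`. -/
theorem IsDual.hasOpSum_sem {S : Prog ty} {W : GOp B} (hW : IsDual B S 1 W) {ρ : GOp B}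
    (hρ : IsPartialDensity ρ) :
    HasOpSum (fun c : Computation B S ρ => c.1) (sem B S ρ) ∧ IsPartialDensity (sem B S ρ) := by
  obtain ⟨A, hA, hA'⟩ := exists_hasOpSum_isPartialDensity
    (f := fun c : Computation B S ρ => c.1) (fun c => (c.2.isPartialDensity hρ).nonneg)
    ((hW.2 ρ hρ).le.trans ((pairing_mono_left hW.1.1 hρ.nonneg hW.1.2).trans hρ.pairing_le))
  rw [sem, hA.opSum_eq]
  exact ⟨hA, hA'⟩

theorem pairing_sem {S : Prog ty} {W : GOp B} (hW : IsDual B S 1 W) (P : GOp B) {ρ : GOp B}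
    (hρ : IsPartialDensity ρ) :
    pairing P (sem B S ρ) = runTotal (some S) ρ (pairing P) :=
  pairing_hasOpSum_right P (fun c => (c.2.isPartialDensity hρ).nonneg) (hW.hasOpSum_sem hρ).1

/-- The dual of `1` guarantees that `sem` is a genuine sum and not the default `0`; both traces are
then finite pairings. -/
theorem totallyCorrect_iff {S : Prog ty} {W : GOp B} (hW : IsDual B S 1 W) {P Q : GOp B}
    (hP : IsPredicate P) (hQ : IsPredicate Q) :
    TotallyCorrect B Q S P ↔
      ∀ ρ, IsPartialDensity ρ → pairing Q ρ ≤ runTotal (some S) ρ (pairing P) := by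
  refine forall₂_congr fun ρ hρ => ?_
  have hs := (hW.hasOpSum_sem hρ).2
  rw [tr_mul_eq hQ.1 hρ.nonneg hρ.pairing_ne_top, tr_mul_eq hP.1 hs.nonneg hs.pairing_ne_top,
    Complex.ofReal_re, Complex.ofReal_re, ENNReal.toReal_le_toReal (hQ.pairing_ne_top hρ)
    (hP.pairing_ne_top hs), pairing_sem hW P hρ]

theorem IsWP.unique {S : Prog ty} {P W W' : GOp B} (h : IsWP B S P W) (h' : IsWP B S P W') :
    W = W' := le_antisymm (h'.2.2 W h.1 h.2.1) (h.2.2 W' h'.1 h'.2.1)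

theorem IsWP.wp_eq {S : Prog ty} {P W : GOp B} (h : IsWP B S P W) : wp B S P = W := by
  have hex : ∃ W, IsWP B S P W := ⟨W, h⟩
  rw [wp, dif_pos hex]
  exact hex.choose_spec.unique h

/-- `W` attains equality in the correctness inequality at every `ρ`, so any other correct `Q` pairs
below `W` everywhere. -/
theorem IsDual.isWP {S : Prog ty} {W₁ P W : GOp B} (h1 : IsDual B S 1 W₁) (hP : IsPredicate P)
    (hW : IsDual B S P W) : IsWP B S P W := by
  refine ⟨hW.1, (totallyCorrect_iff h1 hP hW.1).2 fun ρ hρ => (hW.2 ρ hρ).ge, fun Q hQ hQS => ?_⟩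
  rw [totallyCorrect_iff h1 hP hQ] at hQS
  exact le_of_pairing_le hQ.1 hW.1.1 fun ρ hρ => (hQS ρ hρ).trans (hW.2 ρ hρ).le

theorem IsDual.mono {S : Prog ty} {P P' W W' : GOp B} (h : IsDual B S P W)
    (h' : IsDual B S P' W') (hP : 0 ≤ P) (hPP' : P ≤ P') : W ≤ W' := by
  refine le_of_pairing_le h.1.1 h'.1.1 fun ρ hρ => ?_
  rw [← h.2 ρ hρ, ← h'.2 ρ hρ]
  exact runTotal_mono hρ fun ρ' hρ' => pairing_mono_left hP hρ'.nonneg hPP'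

theorem isDual_skip {P : GOp B} (hP : IsPredicate P) : IsDual B .skip P P :=
  ⟨hP, fun ρ _ => runTotal_skip ρ _⟩

theorem exists_isDual_init (q : Var) {P : GOp B} (hP : IsPredicate P) :
    ∃ W, HasOpSum
      (fun v : (ty q).Val => ketBraAt B q v (ty q).zero * P * ketBraAt B q (ty q).zero v) W ∧
      IsDual B (.init q) P W := by
  obtain ⟨W, hW, hW'⟩ := exists_hasOpSum_conj' (sum_ketBraAt_le B q (ty q).zero)
    (W := fun _ => P) fun _ => hP
  refine ⟨W, by simpa only [ketBraAt_adjoint] using hW, hW', fun ρ hρ => ?_⟩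
  obtain ⟨A, hA, -⟩ := exists_hasOpSum_conj (sum_ketBraAt_le B q (ty q).zero) hρ
  rw [runTotal_init, pairing_hasOpSum_conj (fun _ => hP.1) hW hρ.nonneg,
    ← pairing_hasOpSum_right P (fun v => conj_nonneg hρ.nonneg _) hA]
  simp only [ketBraAt_adjoint] at hA
  rw [hA.opSum_eq]

theorem isDual_unitary {n : ℕ} (qs : Fin n ↪ Var) (U : RegOp ty qs) (hU : U† * U = 1)
    {P : GOp B} (hP : IsPredicate P) :
    IsDual B (.unitary qs U hU) P ((cyl B qs U)† * P * cyl B qs U) := by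
  refine ⟨⟨conj_nonneg' hP.1 _, (conj_mono' hP.2 _).trans ?_⟩, fun ρ hρ => ?_⟩
  · rw [mul_one, cyl_adjoint, ← cyl_mul, hU, cyl_one]
  · rw [runTotal_unitary, pairing_conj hP.1 hρ.nonneg]

theorem IsDual.seq {S₁ S₂ : Prog ty} {P W₁ W₂ : GOp B} (h₂ : IsDual B S₂ P W₂)
    (h₁ : IsDual B S₁ W₂ W₁) : IsDual B (.seq S₁ S₂) P W₁ := by
  refine ⟨h₁.1, fun ρ hρ => ?_⟩
  rw [runTotal_seq, runTotal_congr hρ h₂.2]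
  exact h₁.2 ρ hρ

theorem exists_isDual_measure {n : ℕ} (qs : Fin n ↪ Var) {ι : Type} (M : ι → RegOp ty qs)
    (hM : HasOpSum (fun m => (M m)† * M m) 1) {S : ι → Prog ty} {P : GOp B} {W : ι → GOp B}
    (hW : ∀ m, IsDual B (S m) P (W m)) :
    ∃ A, HasOpSum (fun m => (cyl B qs (M m))† * W m * cyl B qs (M m)) A ∧
      IsDual B (.measure qs M hM S) P A := by
  have hK := sum_cyl_measure_le B qs hM
  obtain ⟨A, hA, hA'⟩ := exists_hasOpSum_conj' hK fun m => (hW m).1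
  refine ⟨A, hA, hA', fun ρ hρ => ?_⟩
  rw [runTotal_measure, pairing_hasOpSum_conj (fun m => (hW m).1.1) hA hρ.nonneg]
  exact tsum_congr fun m => (hW m).2 _ (hρ.conj hK m)

/-- `P_k` accounts for the computations that run the body fewer than `k` times. These include all
with at most `k` transitions (`hle`), and they are among all terminating ones (`hge`); the supremum
over `k` closes the gap. Duality is assumed only for the body, because `loopSeq` refers to its `wp`.
-/
theorem exists_isDual_loop {n : ℕ} (qs : Fin n ↪ Var) (M₀ M₁ : RegOp ty qs)
    (hM : M₀† * M₀ + M₁† * M₁ = 1) {S : Prog ty}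
    (hS : ∀ P, IsPredicate P → IsDual B S P (wp B S P)) {P : GOp B} (hP : IsPredicate P) :
    (∀ k, IsPredicate (loopSeq B qs M₀ M₁ S P k)) ∧ Monotone (loopSeq B qs M₀ M₁ S P) ∧
      ∃ A, IsLUB (Set.range (loopSeq B qs M₀ M₁ S P)) A ∧ IsDual B (.loop qs M₀ M₁ hM S) P A := by
  have hpred : ∀ k, IsPredicate (loopSeq B qs M₀ M₁ S P k) := fun k => by
    induction k with
    | zero => exact isPredicate_zero
    | succ k ih =>
      have hW := (hS _ ih).1
      refine ⟨add_nonneg (conj_nonneg' hP.1 _) (conj_nonneg' hW.1 _), ?_⟩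
      have h := add_le_add (conj_mono' hP.2 (cyl B qs M₀)) (conj_mono' hW.2 (cyl B qs M₁))
      rwa [mul_one, mul_one, cyl_loop B qs hM] at h
  have hmono : Monotone (loopSeq B qs M₀ M₁ S P) := monotone_nat_of_le_succ fun k => by
    induction k with
    | zero => exact (hpred 1).1
    | succ k ih =>
      refine add_le_add le_rfl (conj_mono' ?_ _)
      exact (hS _ (hpred k)).mono (hS _ (hpred (k + 1))) (hpred k).1 ih
  obtain ⟨A, hA, hlub, hpair⟩ := exists_isLUB rfl hmono fun k => (hpred k).2
  have hM₁ : ∀ ρ, IsPartialDensity ρ →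
      IsPartialDensity (cyl B qs M₁ * ρ * (cyl B qs M₁)†) := fun ρ hρ =>
    (Step.loop₁ qs M₀ M₁ hM S ρ).isPartialDensity hρ
  have hsucc : ∀ k ρ, IsPartialDensity ρ → pairing (loopSeq B qs M₀ M₁ S P (k + 1)) ρ =
      pairing P (cyl B qs M₀ * ρ * (cyl B qs M₀)†) +
        runTotal (some S) (cyl B qs M₁ * ρ * (cyl B qs M₁)†)
          (pairing (loopSeq B qs M₀ M₁ S P k)) := fun k ρ hρ => by
    have hW := hS _ (hpred k)
    rw [hW.2 _ (hM₁ ρ hρ), ← pairing_conj hP.1 hρ.nonneg, ← pairing_conj hW.1.1 hρ.nonneg,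
      ← pairing_add_left (conj_nonneg' hP.1 _) (conj_nonneg' hW.1.1 _) hρ.nonneg]
    rfl
  have hle : ∀ k ρ, IsPartialDensity ρ →
      runSum (pairing P) k (some (.loop qs M₀ M₁ hM S)) ρ ≤
        pairing (loopSeq B qs M₀ M₁ S P k) ρ := fun k => by
    induction k with
    | zero => exact fun _ _ => zero_le
    | succ k ih =>
      intro ρ hρ
      rw [hsucc k ρ hρ]
      exact (runSum_loop_le qs M₀ M₁ hM S ρ _ k).trans
        (add_le_add le_rfl (runTotal_mono (hM₁ ρ hρ) ih))
  have hge : ∀ k ρ, IsPartialDensity ρ → pairing (loopSeq B qs M₀ M₁ S P k) ρ ≤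
      runTotal (some (.loop qs M₀ M₁ hM S)) ρ (pairing P) := fun k => by
    induction k with
    | zero =>
      intro ρ hρ
      have h0 : pairing (0 : GOp B) ρ = 0 := by
        -- As second argument `0` makes every term vanish, with no need to know the chosen root of
        -- `0`.
        rw [pairing_comm le_rfl hρ.nonneg]
        simp [pairing, quad]
      exact h0.le.trans zero_le
    | succ k ih =>
      intro ρ hρ
      rw [hsucc k ρ hρ, runTotal_loop]
      exact add_le_add le_rfl (runTotal_mono (hM₁ ρ hρ) ih)
  refine ⟨hpred, hmono, A, hlub, hA, fun ρ hρ => ?_⟩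
  rw [hpair ρ hρ.nonneg]
  exact le_antisymm (runTotal_le fun k => (hle k ρ hρ).trans (le_iSup
    (fun k => pairing (loopSeq B qs M₀ M₁ S P k) ρ) k)) (iSup_le fun k => hge k ρ hρ)

/-- `P` is quantified inside the induction: composition needs the hypothesis at the dual of the
second program, and a loop needs it at `1` and at every approximant. -/
theorem exists_isDual (S : Prog ty) : ∀ P : GOp B, IsPredicate P → ∃ W, IsDual B S P W := by
  induction S with
  | skip => exact fun P hP => ⟨P, isDual_skip hP⟩
  | init q => exact fun P hP => (exists_isDual_init q hP).imp fun _ h => h.2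
  | unitary qs U hU => exact fun P hP => ⟨_, isDual_unitary qs U hU hP⟩
  | seq S₁ S₂ ih₁ ih₂ =>
    intro P hP
    obtain ⟨W₂, h₂⟩ := ih₂ P hP
    obtain ⟨W₁, h₁⟩ := ih₁ W₂ h₂.1
    exact ⟨W₁, h₂.seq h₁⟩
  | measure qs M hM S ih =>
    intro P hP
    choose W hW using fun m => ih m P hP
    exact (exists_isDual_measure qs M hM hW).imp fun _ h => h.2
  | loop qs M₀ M₁ hM S ih =>
    intro P hP
    -- Convergence of the body's semantics, without which its duals could not be identified with
    -- `wp`.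
    obtain ⟨W₁, h₁⟩ := ih 1 isPredicate_one
    have hS : ∀ P, IsPredicate P → IsDual B S P (wp B S P) := fun P hP => by
      obtain ⟨W, hW⟩ := ih P hP
      rwa [(h₁.isWP hP hW).wp_eq]
    obtain ⟨-, -, A, -, hA⟩ := exists_isDual_loop qs M₀ M₁ hM hS hP
    exact ⟨A, hA⟩

theorem IsDual.wp_eq {S : Prog ty} {P W : GOp B} (hP : IsPredicate P) (h : IsDual B S P W) :
    wp B S P = W := by
  obtain ⟨W₁, h₁⟩ := exists_isDual S (1 : GOp B) isPredicate_one
  exact (h₁.isWP hP h).wp_eq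

theorem isDual_wp (S : Prog ty) {P : GOp B} (hP : IsPredicate P) :
    IsDual B S P (wp B S P) := by
  obtain ⟨W, hW⟩ := exists_isDual S P hP
  rwa [hW.wp_eq hP]

/-- Stated for a variable type `t`, since an equation about `ty q` cannot be eliminated by
substitution. -/
theorem hasSum_of_boolean {E : Type*} [AddCommMonoid E] [TopologicalSpace E] {t : Ty}
    (ht : t = .boolean) (f : t.Val → E) : HasSum f (f t.zero + f t.one) := by
  subst ht
  have key : ∀ g : Bool → E, HasSum g (g false + g true) := fun g => by
    rw [add_comm, ← Fintype.sum_bool]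
    exact hasSum_fintype g
  exact key f

end Dual

end QProg

theorem mainTheorem5 {Var : Type} {ty : Var → Ty} (B : GlobalBasis ty) :
    -- weakest preconditions exist and are unique
    (∀ (S : Prog ty) (P : GOp B), IsPredicate P →
      IsWP B S P (wp B S P) ∧ ∀ W : GOp B, IsWP B S P W → W = wp B S P) ∧
    -- skip
    (∀ P : GOp B, IsPredicate P → wp B .skip P = P) ∧
    -- initialisation of a Boolean variable
    (∀ (q : Var) (P : GOp B), IsPredicate P → ty q = .boolean →
      wp B (.init q) P =
        ketBraAt B q (ty q).zero (ty q).zero * P * ketBraAt B q (ty q).zero (ty q).zero +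
        ketBraAt B q (ty q).one (ty q).zero * P * ketBraAt B q (ty q).zero (ty q).one) ∧
    -- initialisation of an integer variable; here the label set of the sum is ℤ
    (∀ (q : Var) (P : GOp B), IsPredicate P → ty q = .integer →
      HasOpSum
        (fun v : (ty q).Val => ketBraAt B q v (ty q).zero * P * ketBraAt B q (ty q).zero v)
        (wp B (.init q) P)) ∧
    -- unitary transformation
    (∀ (n : ℕ) (qs : Fin n ↪ Var) (U : RegOp ty qs) (hU : U† * U = 1) (P : GOp B),
      IsPredicate P →
      wp B (.unitary qs U hU) P = (cyl B qs U)† * P * cyl B qs U) ∧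
    -- sequential composition
    (∀ (S₁ S₂ : Prog ty) (P : GOp B), IsPredicate P →
      wp B (.seq S₁ S₂) P = wp B S₁ (wp B S₂ P)) ∧
    -- measurement
    (∀ (n : ℕ) (qs : Fin n ↪ Var) (ι : Type) (M : ι → RegOp ty qs)
      (hM : HasOpSum (fun m => (M m)† * M m) 1) (S : ι → Prog ty) (P : GOp B),
      IsPredicate P →
      HasOpSum (fun m => (cyl B qs (M m))† * wp B (S m) P * cyl B qs (M m))
        (wp B (.measure qs M hM S) P)) ∧
    -- loop
    (∀ (n : ℕ) (qs : Fin n ↪ Var) (M₀ M₁ : RegOp ty qs)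
      (hM : M₀† * M₀ + M₁† * M₁ = 1) (S : Prog ty) (P : GOp B),
      IsPredicate P →
      (∀ k, IsPredicate (loopSeq B qs M₀ M₁ S P k)) ∧
      Monotone (loopSeq B qs M₀ M₁ S P) ∧
      IsLUB (Set.range (loopSeq B qs M₀ M₁ S P)) (wp B (.loop qs M₀ M₁ hM S) P)) ∧
    -- the trace identity, with the existence of the sum and of the traces that occur in it
    (∀ (S : Prog ty) (P ρ : GOp B), IsPredicate P → IsPartialDensity ρ →
      HasOpSum (fun c : Computation B S ρ => c.1) (sem B S ρ) ∧
      IsPartialDensity (sem B S ρ) ∧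
      IsTraceOp (wp B S P * ρ) ∧
      IsTraceOp (P * sem B S ρ) ∧
      tr (wp B S P * ρ) = tr (P * sem B S ρ)) := by
  refine ⟨fun S P hP => ?_, fun P hP => (isDual_skip hP).wp_eq hP, fun q P hP hq => ?_,
    fun q P hP _ => ?_, fun n qs U hU P hP => (isDual_unitary qs U hU hP).wp_eq hP,
    fun S₁ S₂ P hP => ?_, fun n qs ι M hM S P hP => ?_, fun n qs M₀ M₁ hM S P hP => ?_,
    fun S P ρ hP hρ => ?_⟩
  · have h := (isDual_wp S isPredicate_one).isWP hP (isDual_wp S hP)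
    exact ⟨h, fun W hW => hW.unique h⟩
  · obtain ⟨W, hW, hdual⟩ := exists_isDual_init q hP
    rw [hdual.wp_eq hP]
    exact hW.unique fun ψ => hasSum_of_boolean hq _
  · obtain ⟨W, hW, hdual⟩ := exists_isDual_init q hP
    rwa [hdual.wp_eq hP]
  · have h₂ := isDual_wp S₂ hP
    exact (h₂.seq (isDual_wp S₁ h₂.1)).wp_eq hP
  · obtain ⟨A, hA, hdual⟩ := exists_isDual_measure qs M hM fun m => isDual_wp (S m) hP
    rwa [hdual.wp_eq hP]
  · obtain ⟨hpred, hmono, A, hA, hdual⟩ :=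
      exists_isDual_loop qs M₀ M₁ hM (fun P hP => isDual_wp S hP) hP
    rw [hdual.wp_eq hP]
    exact ⟨hpred, hmono, hA⟩
  · have h₁ := isDual_wp (B := B) S isPredicate_one
    have h := isDual_wp S hP
    obtain ⟨hsum, hdens⟩ := h₁.hasOpSum_sem hρ
    refine ⟨hsum, hdens, isTraceOp_mul h.1.1 hρ.nonneg hρ.pairing_ne_top,
      isTraceOp_mul hP.1 hdens.nonneg hdens.pairing_ne_top, ?_⟩
    -- Both traces become the real value of the same total over computations.
    rw [tr_mul_eq h.1.1 hρ.nonneg hρ.pairing_ne_top,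
      tr_mul_eq hP.1 hdens.nonneg hdens.pairing_ne_top, pairing_sem h₁ P hρ, h.2 ρ hρ]
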